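/- **Setting.** For $k\in\mathbb N$ let $\mathbb R[[X_1,\dots,X_k]]$ be the ring of formal power series. A series $g$ is a *probability generating function* (PGF) if all its coefficients are nonnegative and their sum is at most $1$. A *ReDiP program* over the $\mathbb N$-valued variables $\mathtt x_1,\dots,\mathtt x_k$ is built by the grammar $$P ::= \mathtt x := n \mid \mathtt x\texttt{--} \mid \mathtt x \mathrel{+}= \mathtt{iid}(D,\mathtt y) \mid \mathtt{if}\,(\mathtt x<n)\,\{P\}\,\mathtt{else}\,\{P\} \mid P;P \mid \mathtt{while}\,(\mathtt x<n)\,\{P\},$$ where $\mathtt x,\mathtt y$ are variables (possibly equal), $n\in\mathbb N$, and $D$ is a distribution expression denoting a power series $[\![D]\!]\in\mathbb R[[T]]$. The program is *loop-free* if it contains no $\mathtt{while}$. The semantics of a loop-free program is the map $[\![P]\!]$ from PGFs to PGFs given by - $[\![\mathtt x:=n]\!](g)=g[X/1]\,X^n$, - $[\![\mathtt x\texttt{--}]\!](g)=(g-g[X/0])X^{-1}+g[X/0]$, - $[\![\mathtt x\mathrel{+}=\mathtt{iid}(D,\mathtt y)]\!](g)=g\big[Y/\,Y\cdot[\![D]\!][T/X]\big]$,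 - $[\![\mathtt{if}\,(\mathtt x<n)\,\{P_1\}\,\mathtt{else}\,\{P_2\}]\!](g)=[\![P_1]\!](g_{x<n})+[\![P_2]\!](g-g_{x<n})$, where $g_{x<n}=\sum_{i=0}^{n-1}\frac1{i!}(\partial_X^i g)[X/0]\,X^i$, - $[\![P_1;P_2]\!](g)=[\![P_2]\!]([\![P_1]\!](g))$. **Lemma.** Equivalence of loop-free ReDiP programs whose sampled distributions have rational PGFs is decidable. Precisely: assume that every distribution expression $D$ occurring in a program is given by a rational closed form, i.e. by two polynomials $p,q\in\mathbb Q[T]$ with $q(0)\neq0$ such that the power series $[\![D]\!]=p/q$ is a PGF. Then there is an algorithm that, given $k$ and any two such loop-free programs $P_1,P_2$ over $\mathtt x_1,\dots,\mathtt x_k$, decides whether $[\![P_1]\!]=[\![P_2]\!]$, i.e. whether $[\![P_1]\!](g)=[\![P_2]\!](g)$ for every PGF $g\in\mathbb R[[X_1,\dots,X_k]]$. -/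

import Mathlib

namespace ReDiP

/-! ### Formal power series and probability generating functions -/

/-- `k`-dimensional formal power series, with one indeterminate per program variable. -/
abbrev FPS (k : ℕ) : Type := MvPowerSeries (Fin k) ℝ

/-- A probability generating function: nonnegative coefficients whose (actual) sum is at most `1`.
Sub-probability distributions are included. -/
def IsPGF {ι : Type} (g : MvPowerSeries ι ℝ) : Prop :=
  (∀ σ : ι →₀ ℕ, 0 ≤ MvPowerSeries.coeff σ g) ∧
    Summable (fun σ : ι →₀ ℕ => MvPowerSeries.coeff σ g) ∧
    ∑' σ : ι →₀ ℕ, MvPowerSeries.coeff σ g ≤ 1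

/-- Formal substitution `g[X/h]` of one indeterminate by a power series `h` without constant
coefficient; all other indeterminates are kept. -/
noncomputable def substVar {k : ℕ} (x : Fin k) (h : FPS k) (g : FPS k) : FPS k :=
  MvPowerSeries.subst (Function.update (fun i : Fin k => (MvPowerSeries.X i : FPS k)) x h) g

/-- Substitution by one `g[X/1]`: the coefficients are summed (as a series of reals) along the
dimension `x`. -/
noncomputable def substOne {k : ℕ} (x : Fin k) (g : FPS k) : FPS k :=
  fun σ => if σ x = 0 then ∑' j : ℕ, MvPowerSeries.coeff (σ + Finsupp.single x j) g else 0

/-- The left shift in dimension `x`, written `g X⁻¹` when `g[X/0] = 0`. -/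
noncomputable def leftShift {k : ℕ} (x : Fin k) (g : FPS k) : FPS k :=
  fun σ => MvPowerSeries.coeff (σ + Finsupp.single x 1) g

/-- The filtered series `g_{x<n} = ∑_{i<n} (1/i!) (∂_X^i g)[X/0] X^i`. -/
noncomputable def restrictLt {k : ℕ} (x : Fin k) (n : ℕ) (g : FPS k) : FPS k :=
  ∑ i ∈ Finset.range n,
    ((Nat.factorial i : ℝ)⁻¹ • substVar x 0 ((⇑(MvPowerSeries.pderiv ℝ x))^[i] g)) *
      (MvPowerSeries.X x : FPS k) ^ i

/-! ### Syntax -/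

/-- A distribution expression, given by a rational closed form: the coefficient lists (constant
coefficient first) of a numerator and a denominator polynomial in `T` over `ℚ`. -/
structure DistExpr where
  num : List ℚ
  den : List ℚ

/-- Programs over the program variables `x₀, …, x_{k-1}`. -/
inductive Prog (k : ℕ) : Type
  /-- `x := n` -/
  | assign (x : Fin k) (n : ℕ) : Prog k
  /-- `x--` -/
  | decr (x : Fin k) : Prog k
  /-- `x += iid(D, y)` -/
  | iid (x : Fin k) (D : DistExpr) (y : Fin k) : Prog k
  /-- `if (x < n) {P₁} else {P₂}` -/
  | ite (x : Fin k) (n : ℕ) (P₁ P₂ : Prog k) : Prog k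
  /-- `P₁ ; P₂` -/
  | seq (P₁ P₂ : Prog k) : Prog k
  /-- `while (x < n) {P}` -/
  | loop (x : Fin k) (n : ℕ) (P : Prog k) : Prog k

/-- The program contains no `while` statement. -/
def Prog.LoopFree {k : ℕ} : Prog k → Prop
  | .assign _ _ => True
  | .decr _ => True
  | .iid _ _ _ => True
  | .ite _ _ P Q => P.LoopFree ∧ Q.LoopFree
  | .seq P Q => P.LoopFree ∧ Q.LoopFree
  | .loop _ _ _ => False

/-! ### Semantics -/

/-- The power series in `T` with the finitely many coefficients listed in `l`. -/
noncomputable def listSeries (l : List ℚ) : PowerSeries ℝ :=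
  PowerSeries.mk fun i => ((l.getD i 0 : ℚ) : ℝ)

/-- The power series `num / den` denoted by a distribution expression. -/
noncomputable def DistExpr.sem (D : DistExpr) : PowerSeries ℝ :=
  listSeries D.num * (listSeries D.den)⁻¹

/-- The closed form is legitimate (the denominator is invertible as a power series) and denotes
a PGF. -/
def DistExpr.Valid (D : DistExpr) : Prop :=
  PowerSeries.constantCoeff (listSeries D.den) ≠ 0 ∧ IsPGF (ι := Unit) D.sem

/-- All distribution expressions sampled from in the program are valid. -/
def Prog.Valid {k : ℕ} : Prog k → Prop
  | .assign _ _ => True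
  | .decr _ => True
  | .iid _ D _ => D.Valid
  | .ite _ _ P Q => P.Valid ∧ Q.Valid
  | .seq P Q => P.Valid ∧ Q.Valid
  | .loop _ _ P => P.Valid

/-- The characteristic functional of the loop `while (x < n) {P}` whose body has the
semantics `F`. -/
noncomputable def loopFunctional {k : ℕ} (x : Fin k) (n : ℕ) (F : FPS k → FPS k)
    (ψ : FPS k → FPS k) : FPS k → FPS k :=
  fun f => (f - restrictLt x n f) + ψ (F (restrictLt x n f))

/-- `ψ` is, as a transformer from PGF to PGF, the least fixed point of `Φ` in the pointwise
order. -/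
def IsLfp {k : ℕ} (Φ : (FPS k → FPS k) → FPS k → FPS k) (ψ : FPS k → FPS k) : Prop :=
  (∀ g, IsPGF g → IsPGF (ψ g)) ∧ (∀ g, IsPGF g → Φ ψ g = ψ g) ∧
    ∀ ψ' : FPS k → FPS k, (∀ g, IsPGF g → IsPGF (ψ' g)) → (∀ g, IsPGF g → Φ ψ' g = ψ' g) →
      ∀ g, IsPGF g → ∀ σ, MvPowerSeries.coeff σ (ψ g) ≤ MvPowerSeries.coeff σ (ψ' g)

/-- The transformer `⟦P⟧`; it is meant to be applied to PGF. -/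
noncomputable def Prog.sem {k : ℕ} : Prog k → FPS k → FPS k
  | .assign x n => fun g => substOne x g * (MvPowerSeries.X x : FPS k) ^ n
  | .decr x => fun g => leftShift x (g - substVar x 0 g) + substVar x 0 g
  | .iid x D y => fun g =>
      substVar y (MvPowerSeries.X y * PowerSeries.subst (MvPowerSeries.X x : FPS k) D.sem) g
  | .ite x n P Q => fun g => P.sem (restrictLt x n g) + Q.sem (g - restrictLt x n g)
  | .seq P Q => fun g => Q.sem (P.sem g)
  | .loop x n P => Classical.epsilon (IsLfp (loopFunctional x n P.sem))

/-- `⟦P⟧ = ⟦Q⟧` as functions on PGF. -/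
def Prog.Equivalent {k : ℕ} (P Q : Prog k) : Prop :=
  ∀ g : FPS k, IsPGF g → P.sem g = Q.sem g

/-! ### Programs as inputs of algorithms -/

/-- Code of a list of rationals, each given by its reduced numerator and denominator. -/
def codeList (l : List ℚ) : ℕ :=
  Encodable.encode (l.map fun q => (q.num, q.den))

/-- The code (Gödel number) of a program. -/
def Prog.code {k : ℕ} : Prog k → ℕ
  | .assign x n => Nat.pair 0 (Nat.pair x n)
  | .decr x => Nat.pair 1 x
  | .iid x D y => Nat.pair 2 (Nat.pair x (Nat.pair (Nat.pair (codeList D.num) (codeList D.den)) y))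
  | .ite x n P Q => Nat.pair 3 (Nat.pair (Nat.pair x n) (Nat.pair P.code Q.code))
  | .seq P Q => Nat.pair 4 (Nat.pair P.code Q.code)
  | .loop x n P => Nat.pair 5 (Nat.pair (Nat.pair x n) P.code)

/-- Different lists have different codes. -/
theorem codeList_injective : Function.Injective codeList := by
  intro l l' h
  refine List.map_injective_iff.mpr ?_ (Encodable.encode_injective h)
  intro q q' hq
  simp only [Prod.mk.injEq] at hq
  exact Rat.ext hq.1 hq.2

/-- Different programs have different codes. -/
theorem Prog.code_injective {k : ℕ} : Function.Injective (Prog.code (k := k)) := by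
  intro P
  induction P with
  | assign x n => intro Q h; cases Q <;> simp_all [Prog.code, Nat.pair_eq_pair, Fin.ext_iff]
  | decr x => intro Q h; cases Q <;> simp_all [Prog.code, Nat.pair_eq_pair, Fin.ext_iff]
  | iid x D y =>
    intro Q h
    cases Q with
    | iid x' D' y' =>
      simp only [Prog.code, Nat.pair_eq_pair] at h
      obtain ⟨-, hx, ⟨h1, h2⟩, hy⟩ := h
      cases D; cases D'
      have e1 := codeList_injective h1
      have e2 := codeList_injective h2
      simp_all [Fin.ext_iff]
    | _ => simp [Prog.code, Nat.pair_eq_pair] at h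
  | ite x n P Q hP hQ =>
    intro R h
    cases R with
    | ite x' n' P' Q' =>
      simp only [Prog.code, Nat.pair_eq_pair] at h
      obtain ⟨-, ⟨hx, hn⟩, h1, h2⟩ := h
      rw [hP h1, hQ h2, Fin.ext hx, hn]
    | _ => simp [Prog.code, Nat.pair_eq_pair] at h
  | seq P Q hP hQ =>
    intro R h
    cases R with
    | seq P' Q' =>
      simp only [Prog.code, Nat.pair_eq_pair] at h
      rw [hP h.2.1, hQ h.2.2]
    | _ => simp [Prog.code, Nat.pair_eq_pair] at h
  | loop x n P hP =>
    intro R h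
    cases R with
    | loop x' n' P' =>
      simp only [Prog.code, Nat.pair_eq_pair] at h
      obtain ⟨-, ⟨hx, hn⟩, h1⟩ := h
      rw [hP h1, Fin.ext hx, hn]
    | _ => simp [Prog.code, Nat.pair_eq_pair] at h

end ReDiP

namespace ReDiP

/-! A loop-free program with valid distributions acts on PGFs as a sub-Markov kernel
(`Prog.isKernel_sem`), so it is determined by its values on the point masses X^σ (`IsKernel.ext`).
All these values are treated at once: with one meta-indeterminate U_j for each variable, the family
of all point masses is ∑ X^σ U^σ = ∏ 1/(1 - X_j U_j), a rational function (`rep_init`). A program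
acts on such a family coefficientwise in U (`lift`), and every instruction takes a rational family
to a rational family by an explicit operation on numerators and denominators.

Setting X = 0 or X = 1 in a fraction N/Q may annihilate Q. In that case it annihilates N as well,
since QH = N for a family H on which the substitution is defined; the linear factor is then
cancelled from both, and repeated cancellation ends because the degree drops (`Rep.cancel`). For X =
0 the substitution is a ring homomorphism; for X = 1 it is only compatible with products of a
polynomial and a summable series (`lift_substOne_polyVal_mul`), which is where the PGF property
enters. The decrement is a difference quotient at 0 (`Rep.shift`), the guards are iterated shifts,
and sampling substitutes Y · D(X) for Y and clears denominators. The new denominator is nonzero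
because this substitution is injective for D ≠ 0 (`substVar_sampleFactor_ne_zero`).

Two programs are therefore equivalent exactly when their closed forms agree, and
cross-multiplication in an integral domain reduces this to the vanishing of an integer polynomial
(`isZero_iff`). For computability the polynomials are lists of words, and a program code is first
compiled to a list of stack instructions that is then folded over closed forms; all of this is
primitive recursive. -/

/-- Power series in meta-indeterminates `U_j` over the power series in the `X_j`: families of
power series indexed by an initial state. -/
abbrev UFPS (k : ℕ) : Type := MvPowerSeries (Fin k) (FPS k)

/-! ### Integer polynomials in the X_j and U_j as lists of words. -/

/-- A polynomial as a sum of words; a word is the product of its letters. -/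
abbrev WPoly : Type := List (List ℕ)

/-- The value of a letter: `0` is `-1`, `2 * j + 1` is `X_j` and `2 * j + 2` is `U_j`. -/
noncomputable def letterVal (k : ℕ) : ℕ → UFPS k
  | 0 => -1
  | n + 1 =>
    if h : n / 2 < k then
      if n % 2 = 0 then MvPowerSeries.C (MvPowerSeries.X ⟨n / 2, h⟩) else MvPowerSeries.X ⟨n / 2, h⟩
    else 0

noncomputable def wordVal (k : ℕ) (w : List ℕ) : UFPS k := (w.map (letterVal k)).prod

noncomputable def polyVal (k : ℕ) (F : WPoly) : UFPS k := (F.map (wordVal k)).sum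

section Values
variable {k : ℕ}

@[simp] theorem letterVal_zero : letterVal k 0 = -1 := rfl

@[simp] theorem letterVal_X (x : Fin k) :
    letterVal k (2 * (x : ℕ) + 1) = MvPowerSeries.C (MvPowerSeries.X x) := by
  simp [letterVal]

@[simp] theorem letterVal_U (x : Fin k) : letterVal k (2 * (x : ℕ) + 2) = MvPowerSeries.X x := by
  have h : (2 * (x : ℕ) + 1) / 2 = x := by omega
  have h' : (2 * (x : ℕ) + 1) % 2 = 1 := by omega
  simp [letterVal, h, h']

theorem letterVal_cases (i : ℕ) : i = 0 ∨ (∃ x : Fin k, i = 2 * (x : ℕ) + 1) ∨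
    (∃ x : Fin k, i = 2 * (x : ℕ) + 2) ∨ (2 * k < i ∧ letterVal k i = 0) := by
  rcases i with _ | n
  · exact Or.inl rfl
  · by_cases h : n / 2 < k
    · by_cases h' : n % 2 = 0
      · exact Or.inr (Or.inl ⟨⟨n / 2, h⟩, by simp; omega⟩)
      · exact Or.inr (Or.inr (Or.inl ⟨⟨n / 2, h⟩, by simp; omega⟩))
    · exact Or.inr (Or.inr (Or.inr ⟨by omega, by simp [letterVal, h]⟩))

@[simp] theorem wordVal_nil : wordVal k [] = 1 := rfl

@[simp] theorem wordVal_cons (i : ℕ) (w : List ℕ) :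
    wordVal k (i :: w) = letterVal k i * wordVal k w := by
  simp [wordVal]

@[simp] theorem wordVal_append (v w : List ℕ) :
    wordVal k (v ++ w) = wordVal k v * wordVal k w := by
  simp [wordVal]

@[simp] theorem wordVal_replicate (n i : ℕ) :
    wordVal k (List.replicate n i) = letterVal k i ^ n := by
  simp [wordVal]

@[simp] theorem polyVal_nil : polyVal k [] = 0 := rfl

@[simp] theorem polyVal_cons (w : List ℕ) (F : WPoly) :
    polyVal k (w :: F) = wordVal k w + polyVal k F := by
  simp [polyVal]

@[simp] theorem polyVal_append (F G : WPoly) :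
    polyVal k (F ++ G) = polyVal k F + polyVal k G := by
  simp [polyVal]

@[simp] theorem polyVal_replicate (n : ℕ) (w : List ℕ) :
    polyVal k (List.replicate n w) = n * wordVal k w := by
  simp [polyVal]

theorem polyVal_flatMap {α : Type} (l : List α) (f : α → WPoly) :
    polyVal k (l.flatMap f) = (l.map fun a => polyVal k (f a)).sum := by
  induction l with
  | nil => rfl
  | cons a l ih => simp [ih]

end Values

/-! ### Operations on polynomials -/

namespace WPoly

def neg (F : WPoly) : WPoly := F.map fun w => 0 :: w

def mul (F G : WPoly) : WPoly := F.flatMap fun v => G.map fun w => v ++ w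

def pow (F : WPoly) (n : ℕ) : WPoly := Nat.rec [[]] (fun _ r => mul F r) n

/-- The word without the letter `a`. -/
def strip (a : ℕ) (w : List ℕ) : List ℕ := w.filter fun i => i ≠ a

def num (a : ℕ) (w : List ℕ) : ℕ := (w.filter fun i => i = a).length

/-- Substitution of `0` for a letter. -/
def rem₀ (a : ℕ) (F : WPoly) : WPoly := F.filter fun w => num a w = 0

/-- The quotient by a letter of a polynomial without its constant term in this letter. -/
def quot₀ (a : ℕ) (F : WPoly) : WPoly :=
  (F.filter fun w => num a w ≠ 0).map fun w => strip a w ++ List.replicate (num a w - 1) a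

/-- Substitution of `1` for a letter. -/
def rem₁ (a : ℕ) (F : WPoly) : WPoly := F.map fun w => strip a w

/-- The quotient in the division by the difference of a letter and `1`. -/
def quot₁ (a : ℕ) (F : WPoly) : WPoly :=
  F.flatMap fun w => (List.range (num a w)).map fun i => strip a w ++ List.replicate i a

/-- Substitution of `b * (P / Q)` for the letter `b`, multiplied by `Q ^ M`. -/
def homSubst (b : ℕ) (P Q : WPoly) (M : ℕ) (F : WPoly) : WPoly :=
  F.flatMap fun w => mul [w] (mul (pow P (num b w)) (pow Q (M - num b w)))

end WPoly

/-! ### Values of the operations on polynomials, and division by X and by X - 1. -/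

section
variable {k : ℕ}
open WPoly

@[simp] theorem polyVal_neg (F : WPoly) : polyVal k (neg F) = -polyVal k F := by
  induction F with
  | nil => simp [neg]
  | cons w F ih => 
    have : neg (w :: F) = (0 :: w) :: neg F := rfl
    rw [this]; simp [ih]; ring

@[simp] theorem polyVal_mul (F G : WPoly) : polyVal k (mul F G) = polyVal k F * polyVal k G := by
  induction F with
  | nil => simp [mul]
  | cons w F ih =>
    have : mul (w :: F) G = (G.map fun v => w ++ v) ++ mul F G := rfl
    rw [this, polyVal_append, ih, polyVal_cons, add_mul]
    congr 1
    simp [polyVal, List.map_map, Function.comp_def, List.sum_map_mul_left]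

@[simp] theorem polyVal_pow (F : WPoly) (n : ℕ) : polyVal k (pow F n) = polyVal k F ^ n := by
  induction n with
  | zero => simp [pow]
  | succ n ih =>
    have : pow F (n + 1) = mul F (pow F n) := rfl
    rw [this, polyVal_mul, ih, pow_succ']

theorem wordVal_strip (a : ℕ) (w : List ℕ) :
    wordVal k w = wordVal k (strip a w) * letterVal k a ^ num a w := by
  induction w with
  | nil => simp [strip, num]
  | cons i w ih =>
    by_cases h : i = a
    · subst h
      have h1 : strip i (i :: w) = strip i w := by simp [strip]
      have h2 : num i (i :: w) = num i w + 1 := by simp [num]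
      rw [h1, h2, wordVal_cons, ih]; ring
    · have h1 : strip a (i :: w) = i :: strip a w := by simp [strip, h]
      have h2 : num a (i :: w) = num a w := by simp [num, h]
      rw [h1, h2, wordVal_cons, wordVal_cons, ih]; ring

theorem strip_of_num_eq_zero {a : ℕ} {w : List ℕ} (h : num a w = 0) : strip a w = w := by
  simp only [num, List.length_eq_zero_iff, List.filter_eq_nil_iff, strip, List.filter_eq_self] at h ⊢
  intro i hi; simpa using h i hi

theorem num_strip_append_replicate (a : ℕ) (w : List ℕ) (n : ℕ) :
    num a (strip a w ++ List.replicate n a) = n := by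
  simp [num, strip, List.filter_filter, List.filter_append]

theorem num_le_length (a : ℕ) {F : WPoly} {w : List ℕ} (h : w ∈ F) :
    num a w ≤ F.flatten.length :=
  (List.length_filter_le _ _).trans (List.Sublist.length_le (List.sublist_flatten_of_mem h))

theorem polyVal_div₀ (a : ℕ) (F : WPoly) :
    polyVal k F = polyVal k (rem₀ a F) + letterVal k a * polyVal k (quot₀ a F) := by
  induction F with
  | nil => simp [rem₀, quot₀]
  | cons w F ih =>
    by_cases h : num a w = 0
    · have h1 : rem₀ a (w :: F) = w :: rem₀ a F := by simp [rem₀, h]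
      have h2 : quot₀ a (w :: F) = quot₀ a F := by simp [quot₀, h]
      rw [h1, h2, polyVal_cons, polyVal_cons, ih]; ring
    · have h1 : rem₀ a (w :: F) = rem₀ a F := by simp [rem₀, h]
      have h2 : quot₀ a (w :: F) =
        (strip a w ++ List.replicate (num a w - 1) a) :: quot₀ a F := by simp [quot₀, h]
      obtain ⟨m, hm⟩ := Nat.exists_eq_succ_of_ne_zero h
      rw [h1, h2, polyVal_cons, polyVal_cons, ih, wordVal_strip a w, hm]
      simp; ring

/-- On a single word this is X^n = 1 + (X - 1)(1 + X + ... + X^(n-1)). -/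
theorem polyVal_div₁ (a : ℕ) (F : WPoly) :
    polyVal k F = polyVal k (rem₁ a F) + (letterVal k a - 1) * polyVal k (quot₁ a F) := by
  induction F with
  | nil => simp [rem₁, quot₁]
  | cons w F ih =>
    have h1 : rem₁ a (w :: F) = strip a w :: rem₁ a F := rfl
    have h2 : quot₁ a (w :: F) =
      ((List.range (num a w)).map fun i => strip a w ++ List.replicate i a) ++ quot₁ a F := rfl
    have h3 : polyVal k ((List.range (num a w)).map fun i => strip a w ++ List.replicate i a) =
        wordVal k (strip a w) * ∑ i ∈ Finset.range (num a w), letterVal k a ^ i := by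
      generalize num a w = n
      induction n with
      | zero => simp
      | succ n ih => rw [List.range_succ, List.map_append, polyVal_append, ih,
          Finset.sum_range_succ]; simp; ring
    rw [h1, h2, polyVal_append, h3, polyVal_cons, polyVal_cons, ih, wordVal_strip a w, mul_add,
      mul_left_comm, mul_geom_sum]
    ring

theorem quot₀_eq_nil {a : ℕ} {F : WPoly} (h : ∀ w ∈ F, num a w ≤ 0) : quot₀ a F = [] := by
  simp only [quot₀, List.map_eq_nil_iff, List.filter_eq_nil_iff]
  intro w hw; simpa using h w hw

theorem quot₁_eq_nil {a : ℕ} {F : WPoly} (h : ∀ w ∈ F, num a w ≤ 0) : quot₁ a F = [] := by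
  simp only [quot₁, List.flatMap_eq_nil_iff]
  intro w hw; simp [Nat.le_zero.mp (h w hw)]

theorem num_quot₀ {a n : ℕ} {F : WPoly} (h : ∀ w ∈ F, num a w ≤ n + 1) :
    ∀ w ∈ quot₀ a F, num a w ≤ n := by
  intro w hw
  simp only [quot₀, List.mem_map, List.mem_filter] at hw
  obtain ⟨v, ⟨hv, -⟩, rfl⟩ := hw
  rw [num_strip_append_replicate]
  have := h v hv
  omega

theorem num_quot₁ {a n : ℕ} {F : WPoly} (h : ∀ w ∈ F, num a w ≤ n + 1) :
    ∀ w ∈ quot₁ a F, num a w ≤ n := by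
  intro w hw
  simp only [quot₁, List.mem_map, List.mem_flatMap, List.mem_range] at hw
  obtain ⟨v, hv, i, hi, rfl⟩ := hw
  rw [num_strip_append_replicate]
  have := h v hv
  omega

end

/-! ### Deciding whether a polynomial vanishes -/

namespace WPoly

/-- Only indeterminates with indices less than `k` occur in the word. -/
def Proper (k : ℕ) (w : List ℕ) : Prop := ∀ i ∈ w, i ≤ 2 * k

instance (k : ℕ) (w : List ℕ) : Decidable (Proper k w) := inferInstanceAs (Decidable (∀ i ∈ w, _))

/-- The words have the same exponents. -/
def Similar (k : ℕ) (v w : List ℕ) : Prop := ∀ i < 2 * k, num (i + 1) v = num (i + 1) w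

instance (k : ℕ) (v w : List ℕ) : Decidable (Similar k v w) :=
  inferInstanceAs (Decidable (∀ i < 2 * k, _))

/-- The number of proper words with given exponents and a given sign. -/
def signCount (k : ℕ) (F : WPoly) (w : List ℕ) (s : ℕ) : ℕ :=
  (F.filter fun v => Proper k v ∧ Similar k v w ∧ num 0 v % 2 = s).length

/-- Coefficients are stored by repetition and signs by the parity of the number of letters `0`, so a
coefficient vanishes when positive and negative words balance. Only exponents that occur in `F` have
to be examined; improper words have value 0 and are ignored. -/
def IsZero (k : ℕ) (F : WPoly) : Prop :=
  ∀ w ∈ F, Proper k w → signCount k F w 0 = signCount k F w 1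

instance (k : ℕ) (F : WPoly) : Decidable (IsZero k F) := inferInstanceAs (Decidable (∀ w ∈ F, _))

end WPoly

/-! ### Correctness of the zero test. -/

section
variable {k : ℕ}
open WPoly

/-- The exponents of the `X_j` in a word. -/
noncomputable def expX (k : ℕ) (w : List ℕ) : Fin k →₀ ℕ :=
  Finsupp.equivFunOnFinite.symm fun x => num (2 * (x : ℕ) + 1) w

/-- The exponents of the `U_j` in a word. -/
noncomputable def expU (k : ℕ) (w : List ℕ) : Fin k →₀ ℕ :=
  Finsupp.equivFunOnFinite.symm fun x => num (2 * (x : ℕ) + 2) w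

theorem num_cons (a i : ℕ) (w : List ℕ) : num a (i :: w) = num a w + if i = a then 1 else 0 := by
  by_cases h : i = a <;> simp [num, h]

theorem similar_iff (v w : List ℕ) :
    Similar k v w ↔ expU k v = expU k w ∧ expX k v = expX k w := by
  constructor
  · intro h
    constructor <;> ext x
    · exact h (2 * x + 1) (by omega)
    · exact h (2 * x) (by omega)
  · rintro ⟨h1, h2⟩ i hi
    -- The letter `i + 1` is X_{i/2} for even `i` and U_{i/2} for odd `i`.
    obtain h | h := Nat.even_or_odd' i |>.choose_spec
    · have := DFunLike.congr_fun h2 (⟨i / 2, by omega⟩ : Fin k)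
      have e : 2 * (i / 2) + 1 = i + 1 := by omega
      simpa [expX, e] using this
    · have := DFunLike.congr_fun h1 (⟨i / 2, by omega⟩ : Fin k)
      have e : 2 * (i / 2) + 2 = i + 1 := by omega
      simpa [expU, e] using this

theorem wordVal_of_proper {w : List ℕ} (h : Proper k w) :
    wordVal k w = MvPowerSeries.monomial (expU k w)
      (MvPowerSeries.monomial (expX k w) ((-1 : ℝ) ^ num 0 w)) := by
  induction w with
  | nil =>
    have h1 : expU k [] = 0 := by ext; simp [expU, num]
    have h2 : expX k [] = 0 := by ext; simp [expX, num]
    rw [h1, h2]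
    simp [num, MvPowerSeries.monomial_zero_one]
  | cons i w ih =>
    rw [wordVal_cons, ih fun j hj => h j (List.mem_cons_of_mem _ hj)]
    rcases letterVal_cases (k := k) i with rfl | ⟨x, rfl⟩ | ⟨x, rfl⟩ | ⟨h', -⟩
    · have h1 : expU k (0 :: w) = expU k w := by ext; simp [expU, num_cons]
      have h2 : expX k (0 :: w) = expX k w := by ext; simp [expX, num_cons]
      rw [h1, h2, num_cons]
      simp [pow_succ]
    · have h1 : expU k ((2 * (x : ℕ) + 1) :: w) = expU k w := by
        ext y; simp [expU, num_cons]; omega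
      have h2 : expX k ((2 * (x : ℕ) + 1) :: w) = Finsupp.single x 1 + expX k w := by
        ext y; simp [expX, num_cons, Finsupp.single_apply, Fin.ext_iff]; omega
      rw [h1, h2, num_cons, letterVal_X, ← MvPowerSeries.monomial_zero_eq_C_apply,
        MvPowerSeries.monomial_mul_monomial, MvPowerSeries.X, MvPowerSeries.monomial_mul_monomial]
      simp
    · have h1 : expX k ((2 * (x : ℕ) + 2) :: w) = expX k w := by
        ext y; simp [expX, num_cons]; omega
      have h2 : expU k ((2 * (x : ℕ) + 2) :: w) = Finsupp.single x 1 + expU k w := by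
        ext y; simp [expU, num_cons, Finsupp.single_apply, Fin.ext_iff]; omega
      rw [h1, h2, num_cons, letterVal_U, MvPowerSeries.X, MvPowerSeries.monomial_mul_monomial]
      simp
    · exact absurd (h i (by simp)) (by omega)

theorem wordVal_of_not_proper {w : List ℕ} (h : ¬ Proper k w) : wordVal k w = 0 := by
  simp only [Proper, not_forall] at h
  obtain ⟨i, hi, hik⟩ := h
  refine List.prod_eq_zero (List.mem_map.mpr ⟨i, hi, ?_⟩)
  rcases letterVal_cases (k := k) i with rfl | ⟨x, rfl⟩ | ⟨x, rfl⟩ | ⟨h', h''⟩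
  all_goals first | exact h'' | omega

theorem coeff_polyVal (F : WPoly) (w : List ℕ) :
    MvPowerSeries.coeff (expX k w) (MvPowerSeries.coeff (expU k w) (polyVal k F)) =
      (signCount k F w 0 : ℝ) - signCount k F w 1 := by
  induction F with
  | nil => simp [signCount]
  | cons v F ih =>
    have hm : ∀ s, signCount k (v :: F) w s = signCount k F w s +
        if Proper k v ∧ Similar k v w ∧ num 0 v % 2 = s then 1 else 0 := by
      intro s
      by_cases h : Proper k v ∧ Similar k v w ∧ num 0 v % 2 = s <;>
        simp [signCount, h]
    rw [polyVal_cons, map_add, map_add, ih, hm, hm]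
    by_cases hp : Proper k v
    · rw [wordVal_of_proper hp]
      classical
      by_cases hs : Similar k v w
      · have ⟨h1, h2⟩ := (similar_iff v w).mp hs
        rw [h1, h2, MvPowerSeries.coeff_monomial_same, MvPowerSeries.coeff_monomial_same]
        rcases Nat.mod_two_eq_zero_or_one (num 0 v) with h0 | h0
        · simp [hp, hs, h0, (Nat.even_iff.mpr h0).neg_one_pow]; ring
        · simp [hp, hs, h0, (Nat.odd_iff.mpr h0).neg_one_pow]; ring
      · have : ¬ (expU k v = expU k w ∧ expX k v = expX k w) := fun h => hs ((similar_iff v w).mpr h)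
        have hz : MvPowerSeries.coeff (expX k w) (MvPowerSeries.coeff (expU k w)
            (MvPowerSeries.monomial (expU k v)
              (MvPowerSeries.monomial (expX k v) ((-1 : ℝ) ^ num 0 v)))) = 0 := by
          rw [MvPowerSeries.coeff_monomial]
          split_ifs with h
          · exact MvPowerSeries.coeff_monomial_ne (fun h' => this ⟨h.symm, h'.symm⟩) _
          · rfl
        simp [hz, hs]
    · rw [wordVal_of_not_proper hp]; simp [hp]

theorem isZero_iff (F : WPoly) : IsZero k F ↔ polyVal k F = 0 := by
  constructor
  · intro h
    ext β α
    classical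
    by_cases hw : ∃ w ∈ F, Proper k w ∧ expU k w = β ∧ expX k w = α
    · obtain ⟨w, hw, hp, rfl, rfl⟩ := hw
      rw [coeff_polyVal, h w hw hp]; simp
    · push Not at hw
      rw [polyVal, map_list_sum, map_list_sum, List.map_map, List.map_map]
      simp only [map_zero]
      refine List.sum_eq_zero fun r hr => ?_
      obtain ⟨w, hwF, rfl⟩ := List.mem_map.mp hr
      by_cases hp : Proper k w
      · simp only [Function.comp_apply, wordVal_of_proper hp]
        rw [MvPowerSeries.coeff_monomial]
        split_ifs with h1
        · exact MvPowerSeries.coeff_monomial_ne (fun e => hw w hwF hp h1.symm e.symm) _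
        · simp
      · simp [wordVal_of_not_proper hp]
  · intro h w _ _
    have := coeff_polyVal (k := k) F w
    rw [h] at this
    simp only [map_zero] at this
    exact_mod_cast (sub_eq_zero.mp this.symm)

end

end ReDiP

namespace ReDiP

/-! ### Coefficients of the basic transformations -/

section
variable {k : ℕ}
open MvPowerSeries

theorem hasSubst_update {x : Fin k} {h : FPS k} (hh : constantCoeff h = 0) :
    HasSubst (Function.update (fun i : Fin k => (X i : FPS k)) x h) := by
  refine hasSubst_of_constantCoeff_zero fun s => ?_
  by_cases hs : s = x
  · subst hs; simpa using hh
  · simp [Function.update_of_ne hs]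

/-- This feeds the coefficient formula for substitution: `h = 0` leaves only the monomials free of
`x`, and `h = X x * f` turns X^d into X^d · f^(d x). -/
theorem prod_update_pow (x : Fin k) (h : FPS k) (d : Fin k →₀ ℕ) :
    (d.prod fun s e => Function.update (fun i : Fin k => (X i : FPS k)) x h s ^ e) =
      monomial (d.erase x) 1 * h ^ d x := by
  rw [Finsupp.prod_fintype _ _ fun i => pow_zero _, ← Finset.mul_prod_erase _ _ (Finset.mem_univ x),
    Function.update_self, mul_comm]
  congr 1
  have he : (monomial (d.erase x) 1 : FPS k) = (d.erase x).prod fun s e => (X s : FPS k) ^ e := by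
    simpa using monomial_eq (d.erase x) (fun _ => (1 : ℝ))
  rw [he, Finsupp.prod_fintype _ _ fun i => pow_zero _, ← Finset.mul_prod_erase _ _ (Finset.mem_univ x)]
  simp only [Finsupp.erase_same, pow_zero, one_mul]
  refine Finset.prod_congr rfl fun i hi => ?_
  have : i ≠ x := Finset.ne_of_mem_erase hi
  simp [Function.update_of_ne this, Finsupp.erase_ne this]

theorem coeff_substVar_zero (x : Fin k) (g : FPS k) (τ : Fin k →₀ ℕ) :
    coeff τ (substVar x 0 g) = if τ x = 0 then coeff τ g else 0 := by
  classical
  rw [substVar, coeff_subst (hasSubst_update (map_zero _)), finsum_eq_single _ τ]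
  · rw [prod_update_pow]
    split_ifs with h
    · rw [h, pow_zero, mul_one, Finsupp.erase_of_notMem_support (by simpa using h)]
      simp
    · simp [h]
  · intro d hd
    rw [prod_update_pow]
    by_cases h : d x = 0
    · rw [h, pow_zero, mul_one, Finsupp.erase_of_notMem_support (by simpa using h),
        coeff_monomial_ne hd.symm, smul_zero]
    · simp [h]

theorem coeff_iterate_pderiv (x : Fin k) (i : ℕ) (g : FPS k) (d : Fin k →₀ ℕ) (hd : d x = 0) :
    coeff d ((⇑(pderiv ℝ x))^[i] g) = i.factorial * coeff (d + Finsupp.single x i) g := by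
  -- Each derivative shifts `d`, so the induction needs all `d` at once, with a rising factorial
  -- that becomes `i!` when `d x = 0`.
  have key : ∀ (i : ℕ) (d : Fin k →₀ ℕ), coeff d ((⇑(pderiv ℝ x))^[i] g) =
      ((d x + 1).ascFactorial i : ℕ) * coeff (d + Finsupp.single x i) g := by
    intro i
    induction i with
    | zero => simp
    | succ i ih =>
      intro d
      rw [Function.iterate_succ_apply', coeff_pderiv, ih, add_assoc, ← Finsupp.single_add,
        add_comm 1 i]
      have h := Nat.succ_ascFactorial (d x + 1) i
      rw [← Nat.ascFactorial_succ] at h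
      rw [← h]
      simp
      ring
  rw [key, hd, zero_add, Nat.one_ascFactorial]

theorem coeff_mul_X_pow (x : Fin k) (i : ℕ) (g : FPS k) (τ : Fin k →₀ ℕ) :
    coeff τ (g * X x ^ i) = if i ≤ τ x then coeff (τ - Finsupp.single x i) g else 0 := by
  rw [X_pow_eq, coeff_mul_monomial]
  simp [Finsupp.single_le_iff]

theorem coeff_restrictLt (x : Fin k) (n : ℕ) (g : FPS k) (τ : Fin k →₀ ℕ) :
    coeff τ (restrictLt x n g) = if τ x < n then coeff τ g else 0 := by
  have h : ∀ i, coeff τ (((Nat.factorial i : ℝ)⁻¹ •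
      substVar x 0 ((⇑(pderiv ℝ x))^[i] g)) * (X x : FPS k) ^ i) =
      if i = τ x then coeff τ g else 0 := by
    intro i
    rw [coeff_mul_X_pow]
    by_cases hi : i ≤ τ x
    · rw [if_pos hi, coeff_smul, coeff_substVar_zero]
      by_cases hi' : i = τ x
      · have h0 : (τ - Finsupp.single x i) x = 0 := by simp [hi']
        rw [if_pos h0, if_pos hi', coeff_iterate_pderiv x i g _ h0, tsub_add_cancel_of_le
          (by simpa [Finsupp.single_le_iff] using hi),
          inv_mul_cancel_left₀ (by exact_mod_cast i.factorial_ne_zero)]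
      · rw [if_neg (by simp; omega), if_neg hi', mul_zero]
    · rw [if_neg hi, if_neg (by omega)]
  rw [restrictLt, map_sum]
  simp only [h, Finset.sum_ite_eq', Finset.mem_range]

theorem coeff_leftShift (x : Fin k) (g : FPS k) (τ : Fin k →₀ ℕ) :
    coeff τ (leftShift x g) = coeff (τ + Finsupp.single x 1) g := rfl

theorem coeff_substOne (x : Fin k) (g : FPS k) (τ : Fin k →₀ ℕ) :
    coeff τ (substOne x g) =
      if τ x = 0 then ∑' j : ℕ, coeff (τ + Finsupp.single x j) g else 0 := rfl

theorem coeff_decr (x : Fin k) (g : FPS k) (τ : Fin k →₀ ℕ) :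
    coeff τ (leftShift x (g - substVar x 0 g) + substVar x 0 g) =
      coeff (τ + Finsupp.single x 1) g + if τ x = 0 then coeff τ g else 0 := by
  rw [map_add, coeff_leftShift, map_sub, coeff_substVar_zero, coeff_substVar_zero]
  simp

theorem coeff_assign (x : Fin k) (n : ℕ) (g : FPS k) (τ : Fin k →₀ ℕ) :
    coeff τ (substOne x g * X x ^ n) =
      if τ x = n then ∑' j : ℕ, coeff (τ.erase x + Finsupp.single x j) g else 0 := by
  rw [coeff_mul_X_pow]
  split_ifs with h1 h2 h2
  · have e : τ - Finsupp.single x n = τ.erase x := by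
      ext i
      by_cases hi : i = x
      · subst hi; simp [h2]
      · simp [Finsupp.erase_ne hi, Ne.symm hi]
    rw [e, coeff_substOne, if_pos (by simp)]
  · rw [coeff_substOne, if_neg (by simp; omega)]
  · omega
  · rfl

/-- The factor by which `iid` replaces an indeterminate. -/
noncomputable def sampleFactor (x : Fin k) (D : DistExpr) : FPS k :=
  PowerSeries.subst (X x : FPS k) D.sem

theorem constantCoeff_X_mul_sampleFactor (x y : Fin k) (D : DistExpr) :
    constantCoeff (X y * sampleFactor x D) = 0 := by
  simp

theorem coeff_iid (x y : Fin k) (D : DistExpr) (g : FPS k) (τ : Fin k →₀ ℕ) :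
    coeff τ (substVar y (X y * sampleFactor x D) g) =
      ∑ᶠ d, coeff d g * coeff τ (monomial d 1 * sampleFactor x D ^ d y) := by
  rw [substVar, coeff_subst (hasSubst_update (constantCoeff_X_mul_sampleFactor x y D))]
  refine finsum_congr fun d => ?_
  rw [prod_update_pow, smul_eq_mul, mul_pow, ← mul_assoc, X_pow_eq, monomial_mul_monomial, one_mul,
    Finsupp.erase_add_single]

/-- The substituted series has no constant term, so only finitely many `d` contribute. Hence the
`finsum` of `coeff_iid` may be read as a `tsum`. -/
theorem hasFiniteSupport_iid (x y : Fin k) (D : DistExpr) (g : FPS k) (τ : Fin k →₀ ℕ) :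
    (Function.support fun d =>
      coeff d g * coeff τ (monomial d 1 * sampleFactor x D ^ d y)).Finite := by
  have := coeff_subst_finite (hasSubst_update (x := y) (constantCoeff_X_mul_sampleFactor x y D)) g τ
  refine Set.Finite.subset this fun d hd => ?_
  rw [Function.mem_support] at hd ⊢
  rw [prod_update_pow, smul_eq_mul, mul_pow, ← mul_assoc, X_pow_eq, monomial_mul_monomial, one_mul,
    Finsupp.erase_add_single]
  exact hd

end

/-! ### Probability generating functions by their mass -/

section
open MvPowerSeries
open scoped ENNReal

/-- With values in `ℝ≥0∞`, sums can be interchanged without summability conditions. -/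
noncomputable def mass {ι : Type} (g : MvPowerSeries ι ℝ) : ℝ≥0∞ :=
  ∑' σ : ι →₀ ℕ, ENNReal.ofReal (coeff σ g)

theorem isPGF_iff {ι : Type} {g : MvPowerSeries ι ℝ} :
    IsPGF g ↔ (∀ σ, 0 ≤ coeff σ g) ∧ mass g ≤ 1 := by
  constructor
  · rintro ⟨h0, hs, h1⟩
    refine ⟨h0, ?_⟩
    rw [mass, ← ENNReal.ofReal_tsum_of_nonneg h0 hs]
    simpa using ENNReal.ofReal_le_ofReal h1
  · rintro ⟨h0, h1⟩
    have hs : Summable fun σ => coeff σ g := by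
      have := ENNReal.summable_toReal (ne_top_of_le_ne_top ENNReal.one_ne_top h1)
      simpa [ENNReal.toReal_ofReal, h0] using this
    refine ⟨h0, hs, ?_⟩
    rw [mass, ← ENNReal.ofReal_tsum_of_nonneg h0 hs] at h1
    simpa using h1

theorem mass_mul {ι : Type} [DecidableEq ι] {f g : MvPowerSeries ι ℝ}
    (hf : ∀ σ, 0 ≤ coeff σ f) (hg : ∀ σ, 0 ≤ coeff σ g) : mass (f * g) = mass f * mass g := by
  have h : ∀ τ, ENNReal.ofReal (coeff τ (f * g)) = ∑' p : Finset.HasAntidiagonal.antidiagonal τ,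
      ENNReal.ofReal (coeff p.1.1 f) * ENNReal.ofReal (coeff p.1.2 g) := by
    intro τ
    rw [coeff_mul, ENNReal.ofReal_sum_of_nonneg fun p _ => mul_nonneg (hf _) (hg _),
      Finset.tsum_subtype (Finset.HasAntidiagonal.antidiagonal τ) fun p : (ι →₀ ℕ) × (ι →₀ ℕ) =>
        ENNReal.ofReal (coeff p.1 f) * ENNReal.ofReal (coeff p.2 g)]
    exact Finset.sum_congr rfl fun p _ => ENNReal.ofReal_mul (hf _)
  unfold mass
  rw [tsum_congr h, ← ENNReal.tsum_mul_right]
  simp_rw [← ENNReal.tsum_mul_left]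
  -- Pairs of exponents are grouped by their sum.
  rw [← ENNReal.tsum_prod, ← Finset.HasAntidiagonal.sigmaAntidiagonalEquivProd.tsum_eq, ENNReal.tsum_sigma']
  rfl

theorem IsPGF.mul {ι : Type} {f g : MvPowerSeries ι ℝ} (hf : IsPGF f) (hg : IsPGF g) :
    IsPGF (f * g) := by
  classical
  rw [isPGF_iff] at *
  refine ⟨fun σ => ?_, ?_⟩
  · rw [coeff_mul]; exact Finset.sum_nonneg fun p _ => mul_nonneg (hf.1 _) (hg.1 _)
  · rw [mass_mul hf.1 hg.1]; exact mul_le_one' hf.2 hg.2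

theorem isPGF_monomial {ι : Type} (σ : ι →₀ ℕ) : IsPGF (monomial σ (1 : ℝ)) := by
  classical
  rw [isPGF_iff]
  refine ⟨fun τ => ?_, ?_⟩
  · rw [coeff_monomial]; split_ifs <;> norm_num
  · rw [mass, tsum_eq_single σ fun τ h => by rw [coeff_monomial_ne h, ENNReal.ofReal_zero]]
    simp

theorem IsPGF.pow {ι : Type} {f : MvPowerSeries ι ℝ} (hf : IsPGF f) (n : ℕ) : IsPGF (f ^ n) := by
  induction n with
  | zero => exact isPGF_monomial 0
  | succ n ih => rw [pow_succ]; exact ih.mul hf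

theorem isPGF_subst_X {k : ℕ} (x : Fin k) {f : PowerSeries ℝ} (hf : IsPGF (ι := Unit) f) :
    IsPGF (PowerSeries.subst (X x : FPS k) f) := by
  classical
  rw [isPGF_iff] at *
  have hc : ∀ e : Fin k →₀ ℕ, coeff e (PowerSeries.subst (X x : FPS k) f) =
      if e = Finsupp.single x (e x) then PowerSeries.coeff (e x) f else 0 :=
    fun e => PowerSeries.coeff_subst_single x f e
  refine ⟨fun τ => ?_, ?_⟩
  · rw [hc]; split_ifs
    · exact hf.1 _
    · exact le_rfl
  · refine le_trans (le_of_eq ?_) hf.2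
    unfold mass
    -- The coefficients of `f` in the new indeterminate live on the range of this map.
    have hi : Function.Injective fun n : Unit →₀ ℕ => Finsupp.single x (n ()) := by
      intro m n h
      ext; simpa using Finsupp.single_injective x h
    rw [← hi.tsum_eq]
    · refine tsum_congr fun n => ?_
      rw [hc]
      have : Finsupp.single () (n ()) = n := by ext; simp
      simp [PowerSeries.coeff, this]
    · intro e he
      rw [Function.mem_support, hc] at he
      split_ifs at he with h
      · exact ⟨Finsupp.single () (e x), by simpa using h.symm⟩
      · simp at he

end
end ReDiP

namespace ReDiP

/-! ### Programs as sub-Markov kernels -/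

section
open MvPowerSeries
open scoped ENNReal
variable {k : ℕ}

/-- The map is given on PGF by a sub-Markov kernel. -/
def IsKernel (F : FPS k → FPS k) : Prop :=
  ∃ K : (Fin k →₀ ℕ) → (Fin k →₀ ℕ) → ℝ≥0∞, (∀ σ, ∑' τ, K σ τ ≤ 1) ∧
    ∀ g, IsPGF g → ∀ τ, 0 ≤ coeff τ (F g) ∧
      ENNReal.ofReal (coeff τ (F g)) = ∑' σ, ENNReal.ofReal (coeff σ g) * K σ τ

theorem IsKernel.isPGF {F : FPS k → FPS k} (hF : IsKernel F) {g : FPS k} (hg : IsPGF g) :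
    IsPGF (F g) := by
  obtain ⟨K, hK, h⟩ := hF
  refine isPGF_iff.mpr ⟨fun τ => (h g hg τ).1, ?_⟩
  unfold mass
  rw [tsum_congr fun τ => (h g hg τ).2, ENNReal.tsum_comm]
  refine le_trans ?_ (isPGF_iff.mp hg).2
  refine ENNReal.tsum_le_tsum fun σ => ?_
  rw [ENNReal.tsum_mul_left]
  exact mul_le_of_le_one_right' (hK σ)

/-- On a point mass the kernel formula returns one row of the kernel, so agreement on point masses
makes the two kernels equal. -/
theorem IsKernel.ext {F G : FPS k → FPS k} (hF : IsKernel F) (hG : IsKernel G)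
    (h : ∀ σ, F (monomial σ 1) = G (monomial σ 1)) {g : FPS k} (hg : IsPGF g) : F g = G g := by
  obtain ⟨K, -, hK⟩ := hF
  obtain ⟨L, -, hL⟩ := hG
  have hmon : ∀ (M : (Fin k →₀ ℕ) → (Fin k →₀ ℕ) → ℝ≥0∞) (σ τ : Fin k →₀ ℕ),
      ∑' ρ, ENNReal.ofReal (coeff ρ (monomial σ (1 : ℝ))) * M ρ τ = M σ τ := by
    intro M σ τ
    rw [tsum_eq_single σ fun ρ hρ => by rw [coeff_monomial_ne hρ, ENNReal.ofReal_zero, zero_mul]]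
    simp
  have hKL : K = L := by
    funext σ τ
    rw [← hmon K σ τ, ← hmon L σ τ, ← (hK _ (isPGF_monomial σ) τ).2,
      ← (hL _ (isPGF_monomial σ) τ).2, h]
  ext τ
  have h1 := hK g hg τ
  have h2 := hL g hg τ
  rw [← ENNReal.toReal_ofReal h1.1, ← ENNReal.toReal_ofReal h2.1, h1.2, h2.2, hKL]

theorem IsKernel.comp {F G : FPS k → FPS k} (hG : IsKernel G) (hF : IsKernel F) :
    IsKernel fun g => G (F g) := by
  have hpgf := @IsKernel.isPGF _ _ hF
  obtain ⟨K, hK1, hK⟩ := hF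
  obtain ⟨L, hL1, hL⟩ := hG
  refine ⟨fun σ τ => ∑' ρ, K σ ρ * L ρ τ, fun σ => ?_, fun g hg τ => ⟨(hL _ (hpgf hg) τ).1, ?_⟩⟩
  · rw [ENNReal.tsum_comm]
    refine le_trans (ENNReal.tsum_le_tsum fun ρ => ?_) (hK1 σ)
    rw [ENNReal.tsum_mul_left]
    exact mul_le_of_le_one_right' (hL1 ρ)
  · rw [(hL _ (hpgf hg) τ).2]
    simp_rw [(hK g hg _).2, ← ENNReal.tsum_mul_right, ← ENNReal.tsum_mul_left]
    rw [ENNReal.tsum_comm]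
    simp only [mul_assoc]

theorem IsPGF.of_le {f g : FPS k} (hg : IsPGF g) (h0 : ∀ τ, 0 ≤ coeff τ f)
    (h : ∀ τ, coeff τ f ≤ coeff τ g) : IsPGF f :=
  isPGF_iff.mpr ⟨h0, (ENNReal.tsum_le_tsum fun τ => ENNReal.ofReal_le_ofReal (h τ)).trans
    (isPGF_iff.mp hg).2⟩

theorem IsPGF.restrictLt (x : Fin k) (n : ℕ) {g : FPS k} (hg : IsPGF g) :
    IsPGF (restrictLt x n g) := by
  have := hg.1
  refine hg.of_le (fun τ => ?_) fun τ => ?_ <;> rw [coeff_restrictLt] <;> split_ifs <;> simp [this]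

theorem IsPGF.sub_restrictLt (x : Fin k) (n : ℕ) {g : FPS k} (hg : IsPGF g) :
    IsPGF (g - ReDiP.restrictLt x n g) := by
  have := hg.1
  refine hg.of_le (fun τ => ?_) fun τ => ?_ <;> rw [map_sub, coeff_restrictLt] <;> split_ifs <;>
    simp [this]

/-- The guard depends only on the initial state, so each row of the combined kernel is a row of one
of the branches. -/
theorem IsKernel.ite {F G : FPS k → FPS k} (hF : IsKernel F) (hG : IsKernel G) (x : Fin k)
    (n : ℕ) : IsKernel fun g => F (restrictLt x n g) + G (g - restrictLt x n g) := by
  obtain ⟨K, hK1, hK⟩ := hF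
  obtain ⟨L, hL1, hL⟩ := hG
  refine ⟨fun σ τ => if σ x < n then K σ τ else L σ τ, fun σ => ?_, fun g hg τ => ?_⟩
  · beta_reduce
    split_ifs
    exacts [hK1 σ, hL1 σ]
  · have h1 := hK _ (hg.restrictLt x n) τ
    have h2 := hL _ (hg.sub_restrictLt x n) τ
    rw [map_add]
    refine ⟨add_nonneg h1.1 h2.1, ?_⟩
    rw [ENNReal.ofReal_add h1.1 h2.1, h1.2, h2.2, ← ENNReal.tsum_add]
    refine tsum_congr fun σ => ?_
    rw [map_sub, coeff_restrictLt]
    by_cases hσ : σ x < n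
    · simp [hσ]
    · simp [hσ]

theorem tsum_ite_eq_le_one {ι : Type} (a : ι) [DecidableEq ι] :
    ∑' τ, (if τ = a then (1 : ℝ≥0∞) else 0) ≤ 1 := by
  simp

theorem isKernel_decr (x : Fin k) :
    IsKernel fun g : FPS k => leftShift x (g - substVar x 0 g) + substVar x 0 g := by
  classical
  refine ⟨fun σ τ => if τ = σ - Finsupp.single x 1 then 1 else 0, fun σ => tsum_ite_eq_le_one _,
    fun g hg τ => ?_⟩
  have h0 := hg.1
  rw [coeff_decr]
  have hif : 0 ≤ if τ x = 0 then coeff τ g else 0 := by split_ifs <;> simp [h0]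
  refine ⟨add_nonneg (h0 _) hif, ?_⟩
  rw [ENNReal.ofReal_add (h0 _) hif]
  -- The state `τ` is reached from `τ` with `x` increased by one and, because subtraction is
  -- truncated, also from `τ` itself when `τ x = 0`.
  have hsplit : ∀ σ, ENNReal.ofReal (coeff σ g) *
      (if τ = σ - Finsupp.single x 1 then (1 : ℝ≥0∞) else 0) =
      (if σ = τ + Finsupp.single x 1 then ENNReal.ofReal (coeff σ g) else 0) +
      (if σ = τ then ENNReal.ofReal (if τ x = 0 then coeff τ g else 0) else 0) := by
    intro σ
    by_cases h1 : σ = τ + Finsupp.single x 1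
    · subst h1; simp
    · rw [if_neg h1, zero_add]
      by_cases h2 : σ = τ
      · subst h2
        by_cases h3 : σ x = 0
        · have : σ = σ - Finsupp.single x 1 := by
            ext i; by_cases hi : i = x
            · subst hi; simp [h3]
            · simp [Ne.symm hi]
          simp [h3, ← this]
        · have : σ ≠ σ - Finsupp.single x 1 := by
            intro h; have := DFunLike.congr_fun h x; simp at this; omega
          simp [h3, this]
      · rw [if_neg h2, if_neg, mul_zero]
        intro h
        by_cases h3 : σ x = 0
        · refine h2 (h ▸ ?_)
          ext i; by_cases hi : i = x
          · subst hi; simp [h3]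
          · simp [Ne.symm hi]
        · refine h1 (h ▸ ?_)
          rw [tsub_add_cancel_of_le]
          simp [Finsupp.single_le_iff]; omega
  rw [tsum_congr hsplit, ENNReal.tsum_add, tsum_ite_eq, tsum_ite_eq]

theorem isKernel_assign (x : Fin k) (n : ℕ) :
    IsKernel fun g : FPS k => substOne x g * X x ^ n := by
  classical
  refine ⟨fun σ τ => if τ = σ.erase x + Finsupp.single x n then 1 else 0,
    fun σ => tsum_ite_eq_le_one _, fun g hg τ => ?_⟩
  have h0 := hg.1
  -- The states sent to `τ` are those that differ from it at most at `x`; this map enumerates them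
  -- by their value at `x`.
  have hi : Function.Injective fun j : ℕ => τ.erase x + Finsupp.single x j := by
    intro i j h
    exact Finsupp.single_injective x (add_left_cancel h)
  rw [coeff_assign]
  refine ⟨by split_ifs; exacts [tsum_nonneg fun _ => h0 _, le_rfl], ?_⟩
  split_ifs with h
  · rw [ENNReal.ofReal_tsum_of_nonneg (fun _ => h0 _) (hg.2.1.comp_injective hi), ← hi.tsum_eq]
    · refine tsum_congr fun j => ?_
      beta_reduce
      rw [if_pos, mul_one]
      ext i
      by_cases hix : i = x
      · subst hix; simp [h]
      · simp [hix, Finsupp.erase_ne]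
    · intro σ hσ
      rw [Function.mem_support] at hσ
      have : τ = σ.erase x + Finsupp.single x n := by
        by_contra hne; simp [hne] at hσ
      refine ⟨σ x, ?_⟩
      ext i
      by_cases hix : i = x
      · subst hix; simp
      · simp [this, hix, Finsupp.erase_ne]
  · rw [ENNReal.ofReal_zero, eq_comm, ENNReal.tsum_eq_zero]
    intro σ
    beta_reduce
    rw [if_neg, mul_zero]
    rintro rfl
    simp at h

theorem isPGF_sampleFactor (x : Fin k) {D : DistExpr} (hD : D.Valid) :
    IsPGF (sampleFactor x D) := isPGF_subst_X x hD.2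

theorem isKernel_iid (x y : Fin k) {D : DistExpr} (hD : D.Valid) :
    IsKernel fun g : FPS k => substVar y (X y * sampleFactor x D) g := by
  have hK : ∀ σ : Fin k →₀ ℕ, IsPGF (monomial σ 1 * sampleFactor x D ^ σ y) := fun σ =>
    (isPGF_monomial σ).mul ((isPGF_sampleFactor x hD).pow _)
  refine ⟨fun σ τ => ENNReal.ofReal (coeff τ (monomial σ 1 * sampleFactor x D ^ σ y)),
    fun σ => (isPGF_iff.mp (hK σ)).2, fun g hg τ => ?_⟩
  have hfin := hasFiniteSupport_iid x y D g τ
  have hnn : ∀ d, 0 ≤ coeff d g * coeff τ (monomial d 1 * sampleFactor x D ^ d y) :=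
    fun d => mul_nonneg (hg.1 d) ((hK d).1 τ)
  rw [coeff_iid, ← tsum_eq_finsum (L := .unconditional _) hfin]
  refine ⟨tsum_nonneg hnn, ?_⟩
  rw [ENNReal.ofReal_tsum_of_nonneg hnn (summable_of_hasFiniteSupport hfin)]
  exact tsum_congr fun d => ENNReal.ofReal_mul (hg.1 d)

theorem Prog.isKernel_sem {P : Prog k} (hf : P.LoopFree) (hv : P.Valid) : IsKernel P.sem := by
  induction P with
  | assign x n => exact isKernel_assign x n
  | decr x => exact isKernel_decr x
  | iid x D y => exact isKernel_iid x y hv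
  | ite x n P Q ihP ihQ => exact (ihP hf.1 hv.1).ite (ihQ hf.2 hv.2) x n
  | seq P Q ihP ihQ => exact (ihQ hf.2 hv.2).comp (ihP hf.1 hv.1)
  | loop x n P => exact hf.elim

end
end ReDiP

namespace ReDiP

/-! ### Closed forms -/

/-- A rational function in the indeterminates, as numerator and denominator. -/
abbrev Frac : Type := WPoly × WPoly

namespace Frac
open WPoly

def add (f g : Frac) : Frac := (mul f.1 g.2 ++ mul g.1 f.2, mul f.2 g.2)

def neg (f : Frac) : Frac := (WPoly.neg f.1, f.2)

/-- Multiplication by a word. -/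
def scale (w : List ℕ) (f : Frac) : Frac := (mul [w] f.1, f.2)

def cancelStep (k : ℕ) (rem quot : WPoly → WPoly) (f : Frac) : Frac :=
  if IsZero k (rem f.2) then (quot f.1, quot f.2) else f

/-- Division of numerator and denominator by a linear factor as long as it divides the
denominator. -/
def cancel (k : ℕ) (rem quot : WPoly → WPoly) (f : Frac) : Frac :=
  (cancelStep k rem quot)^[f.2.flatten.length + 1] f

def cancel₀ (k a : ℕ) (f : Frac) : Frac := cancel k (rem₀ a) (quot₀ a) f

def cancel₁ (k a : ℕ) (f : Frac) : Frac := cancel k (rem₁ a) (quot₁ a) f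

def eval₀ (k a : ℕ) (f : Frac) : Frac :=
  (rem₀ a (cancel₀ k a f).1, rem₀ a (cancel₀ k a f).2)

def eval₁ (k a : ℕ) (f : Frac) : Frac :=
  (rem₁ a (cancel₁ k a f).1, rem₁ a (cancel₁ k a f).2)

/-- The difference quotient at `0` of `g` by its value at `0`. -/
def shiftAux (a : ℕ) (g : Frac) : Frac :=
  (mul (quot₀ a g.1) (rem₀ a g.2) ++ WPoly.neg (mul (rem₀ a g.1) (quot₀ a g.2)),
    mul g.2 (rem₀ a g.2))

def shift (k a : ℕ) (f : Frac) : Frac := shiftAux a (cancel₀ k a f)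

def decr (k a : ℕ) (f : Frac) : Frac := add (shift k a f) (eval₀ k a f)

def assign (k a n : ℕ) (f : Frac) : Frac := scale (List.replicate n a) (eval₁ k a f)

def ge (k a n : ℕ) (f : Frac) : Frac := scale (List.replicate n a) ((shift k a)^[n] f)

def lt (k a n : ℕ) (f : Frac) : Frac := add f (neg (ge k a n f))

/-- Substitution of `b * d` for the letter `b`. -/
def subst (k b : ℕ) (f d : Frac) : Frac :=
  if IsZero k d.1 then eval₀ k b f
  else
    (homSubst b d.1 d.2 (f.1.flatten.length + f.2.flatten.length) f.1,
      homSubst b d.1 d.2 (f.1.flatten.length + f.2.flatten.length) f.2)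

end Frac

/-! ### Correctness of the operations on fractions. -/

section
open MvPowerSeries
variable {k : ℕ}

/-- `f` is a closed form of the family `H`. -/
def Rep (f : Frac) (H : UFPS k) : Prop :=
  polyVal k f.2 ≠ 0 ∧ polyVal k f.2 * H = polyVal k f.1

/-- The transformer applied to all members of a family. -/
noncomputable def lift (F : FPS k → FPS k) (H : UFPS k) : UFPS k := fun σ => F (coeff σ H)

@[simp] theorem coeff_lift (F : FPS k → FPS k) (H : UFPS k) (σ : Fin k →₀ ℕ) :
    coeff σ (lift F H) = F (coeff σ H) := rfl

theorem Rep.add {f g : Frac} {H G : UFPS k} (hf : Rep f H) (hg : Rep g G) :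
    Rep (f.add g) (H + G) := by
  refine ⟨?_, ?_⟩
  · simpa [Frac.add] using ⟨hf.1, hg.1⟩
  · simp only [Frac.add, polyVal_mul, polyVal_append, ← hf.2, ← hg.2]; ring

theorem Rep.neg {f : Frac} {H : UFPS k} (hf : Rep f H) : Rep f.neg (-H) :=
  ⟨hf.1, by simp [Frac.neg, hf.2]⟩

theorem Rep.scale {f : Frac} {H : UFPS k} (hf : Rep f H) (w : List ℕ) :
    Rep (f.scale w) (wordVal k w * H) := by
  refine ⟨hf.1, ?_⟩
  simp only [Frac.scale, polyVal_mul, ← hf.2, polyVal_cons, polyVal_nil]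
  ring

/-- Common argument for the evaluations at 0 and at 1: `d` is the linear factor and `H'` the
evaluated family. By `hdiv`, a vanishing remainder means divisibility by `d`, and by `hrem` a
vanishing remainder of the denominator forces that of the numerator. -/
theorem Rep.cancel {rem quot : WPoly → WPoly} {a : ℕ} {d : UFPS k} (hd : d ≠ 0)
    (hdiv : ∀ F, polyVal k F = polyVal k (rem F) + d * polyVal k (quot F))
    (hnum : ∀ n F, (∀ w ∈ F, WPoly.num a w ≤ n + 1) → ∀ w ∈ quot F, WPoly.num a w ≤ n)
    (hnil : ∀ F, (∀ w ∈ F, WPoly.num a w ≤ 0) → quot F = [])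
    {H H' : UFPS k} (hrem : ∀ N Q, polyVal k Q * H = polyVal k N →
      polyVal k (rem Q) * H' = polyVal k (rem N))
    {f : Frac} (hf : Rep f H) :
    polyVal k (rem (f.cancel k rem quot).2) ≠ 0 ∧ Rep (f.cancel k rem quot) H := by
  have key : ∀ n (f : Frac), Rep f H → (∀ w ∈ f.2, WPoly.num a w ≤ n) →
      polyVal k (rem ((Frac.cancelStep k rem quot)^[n + 1] f).2) ≠ 0 ∧
        Rep ((Frac.cancelStep k rem quot)^[n + 1] f) H := by
    intro n
    induction n with
    | zero =>
      intro f hf hn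
      -- In degree 0 the denominator is its own remainder, so no further cancellation takes place.
      have h0 : polyVal k (rem f.2) ≠ 0 := by
        have := hdiv f.2
        rw [hnil _ hn, polyVal_nil, mul_zero, add_zero] at this
        exact this ▸ hf.1
      have : Frac.cancelStep k rem quot f = f := if_neg (by rwa [isZero_iff])
      simpa [this] using ⟨h0, hf⟩
    | succ n ih =>
      intro f hf hn
      by_cases h0 : polyVal k (rem f.2) = 0
      · have hstep : Frac.cancelStep k rem quot f = (quot f.1, quot f.2) :=
          if_pos (by rwa [isZero_iff])
        have h1 : polyVal k (rem f.1) = 0 := by rw [← hrem _ _ hf.2, h0, zero_mul]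
        have e1 := hdiv f.1
        have e2 := hdiv f.2
        rw [h1, zero_add] at e1
        rw [h0, zero_add] at e2
        rw [Function.iterate_succ_apply, hstep]
        refine ih _ ⟨fun h => hf.1 (by rw [e2]; simp [h]), mul_left_cancel₀ hd ?_⟩ (hnum n _ hn)
        rw [← mul_assoc, ← e1, ← e2, hf.2]
      · have hstep : Frac.cancelStep k rem quot f = f := if_neg (by rwa [isZero_iff])
        rw [Function.iterate_fixed hstep]
        exact ⟨h0, hf⟩
  -- The degree in `a` is at most the total number of letters; `Frac.cancel` iterates once more than
  -- that.
  exact key _ f hf fun w hw => num_le_length a hw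

/-! ### Substitutions that are ring homomorphisms -/

noncomputable def substHom (x : Fin k) (h : FPS k) (hh : constantCoeff h = 0) :
    UFPS k →+* UFPS k :=
  MvPowerSeries.map (substAlgHom (R := ℝ) (hasSubst_update (x := x) hh) : FPS k →+* FPS k)

theorem substHom_apply (x : Fin k) (h : FPS k) (hh : constantCoeff h = 0) (H : UFPS k) :
    substHom x h hh H = lift (substVar x h) H := by
  ext1 σ
  rw [substHom, coeff_map, coeff_lift, substVar, ← coe_substAlgHom (hasSubst_update hh)]
  rfl

theorem substHom_letterVal_self (x : Fin k) (h : FPS k) (hh : constantCoeff h = 0) :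
    substHom x h hh (letterVal k (2 * (x : ℕ) + 1)) = C h := by
  rw [letterVal_X, substHom, map_C]
  congr 1
  change substAlgHom (hasSubst_update hh) (X x) = h
  rw [substAlgHom_X, Function.update_self]

theorem substHom_letterVal {x : Fin k} {h : FPS k} (hh : constantCoeff h = 0) {i : ℕ}
    (hi : i ≠ 2 * (x : ℕ) + 1) : substHom x h hh (letterVal k i) = letterVal k i := by
  rcases letterVal_cases (k := k) i with rfl | ⟨y, rfl⟩ | ⟨y, rfl⟩ | ⟨-, h0⟩
  · simp
  · have hy : y ≠ x := by rintro rfl; exact hi rfl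
    rw [letterVal_X, substHom, map_C]
    congr 1
    change substAlgHom (hasSubst_update hh) (X y) = X y
    rw [substAlgHom_X, Function.update_of_ne hy]
  · rw [letterVal_U, substHom, map_X]
  · rw [h0, map_zero]

theorem substHom_wordVal {x : Fin k} {h : FPS k} (hh : constantCoeff h = 0) (w : List ℕ) :
    substHom x h hh (wordVal k w) =
      wordVal k (WPoly.strip (2 * x + 1) w) * C h ^ WPoly.num (2 * x + 1) w := by
  rw [wordVal_strip (2 * (x : ℕ) + 1) w, map_mul, map_pow, substHom_letterVal_self]
  congr 1
  rw [wordVal, map_list_prod, List.map_map]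
  congr 1
  refine List.map_congr_left fun i hi => substHom_letterVal hh ?_
  simpa using (List.mem_filter.mp hi).2

theorem substHom_zero_polyVal (x : Fin k) (F : WPoly) :
    substHom x 0 (map_zero _) (polyVal k F) = polyVal k (WPoly.rem₀ (2 * x + 1) F) := by
  induction F with
  | nil => simp [WPoly.rem₀]
  | cons w F ih =>
    rw [polyVal_cons, map_add, ih, substHom_wordVal]
    by_cases h : WPoly.num (2 * (x : ℕ) + 1) w = 0
    · simp [WPoly.rem₀, h, strip_of_num_eq_zero h]
    · simp [WPoly.rem₀, h]

theorem letterVal_X_ne_zero (x : Fin k) : letterVal k (2 * (x : ℕ) + 1) ≠ 0 := by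
  rw [letterVal_X]
  intro h
  rw [← map_zero C] at h
  have := congrArg (coeff (Finsupp.single x 1)) (C_injective h)
  simp [coeff_index_single_self_X] at this

theorem rem₀_mul_lift {x : Fin k} {H : UFPS k} {N Q : WPoly}
    (h : polyVal k Q * H = polyVal k N) :
    polyVal k (WPoly.rem₀ (2 * x + 1) Q) * lift (substVar x 0) H =
      polyVal k (WPoly.rem₀ (2 * x + 1) N) := by
  rw [← substHom_zero_polyVal, ← substHom_zero_polyVal, ← h, map_mul,
    substHom_apply _ _ _ H]

theorem Rep.cancel₀ {f : Frac} {H : UFPS k} (hf : Rep f H) (x : Fin k) :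
    polyVal k (WPoly.rem₀ (2 * x + 1) (f.cancel₀ k (2 * x + 1)).2) ≠ 0 ∧
      Rep (f.cancel₀ k (2 * x + 1)) H :=
  hf.cancel (letterVal_X_ne_zero x) (polyVal_div₀ _) (fun _ _ => num_quot₀)
    (fun _ => quot₀_eq_nil) (fun _ _ => rem₀_mul_lift)

theorem Rep.eval₀ {f : Frac} {H : UFPS k} (hf : Rep f H) (x : Fin k) :
    Rep (f.eval₀ k (2 * x + 1)) (lift (substVar x 0) H) :=
  ⟨(hf.cancel₀ x).1, rem₀_mul_lift (hf.cancel₀ x).2.2⟩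

/-- The division with remainder by X in power series; lifted to families it characterises the shift,
since X is not a zero divisor. -/
theorem eq_substVar_add (x : Fin k) (g : FPS k) :
    g = substVar x 0 g + X x * leftShift x g := by
  ext τ
  rw [map_add, coeff_substVar_zero, mul_comm, ← pow_one (X x : FPS k), coeff_mul_X_pow,
    coeff_leftShift]
  by_cases h : τ x = 0
  · simp [h]
  · rw [if_neg h, if_pos (by omega), zero_add, tsub_add_cancel_of_le]
    simp [Finsupp.single_le_iff]; omega

theorem lift_eq_add (x : Fin k) (H : UFPS k) :
    H = lift (substVar x 0) H + letterVal k (2 * (x : ℕ) + 1) * lift (leftShift x) H := by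
  ext1 σ
  rw [letterVal_X, map_add, coeff_C_mul, coeff_lift, coeff_lift]
  exact eq_substVar_add x _

theorem Rep.shift {f : Frac} {H : UFPS k} (hf : Rep f H) (x : Fin k) :
    Rep (f.shift k (2 * x + 1)) (lift (leftShift x) H) := by
  obtain ⟨h0, h1, h2⟩ := hf.cancel₀ x
  have h3 := rem₀_mul_lift (x := x) h2
  have h4 := lift_eq_add x H
  rw [Frac.shift]
  generalize f.cancel₀ k (2 * x + 1) = g at *
  have e1 := polyVal_div₀ (k := k) (2 * x + 1) g.1
  have e2 := polyVal_div₀ (k := k) (2 * x + 1) g.2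
  refine ⟨by simpa [Frac.shiftAux] using ⟨h1, h0⟩, mul_left_cancel₀ (letterVal_X_ne_zero x) ?_⟩
  simp only [Frac.shiftAux, polyVal_mul, polyVal_append, polyVal_neg]
  generalize polyVal k g.1 = N at *
  generalize polyVal k g.2 = Q at *
  generalize lift (substVar x 0) H = H0 at *
  generalize lift (leftShift x) H = H1 at *
  generalize polyVal k (WPoly.rem₀ (2 * x + 1) g.2) = Q0 at *
  generalize polyVal k (WPoly.rem₀ (2 * x + 1) g.1) = N0 at *
  -- With N = N0 + X N1 and Q = Q0 + X Q1, one has N/Q - N0/Q0 = X (N1 Q0 - N0 Q1)/(Q Q0).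
  linear_combination (-Q * Q0) * h4 + Q0 * h2 - Q * h3 + Q0 * e1 - N0 * e2

theorem lift_decr (x : Fin k) (H : UFPS k) :
    lift (fun g => leftShift x (g - substVar x 0 g) + substVar x 0 g) H =
      lift (leftShift x) H + lift (substVar x 0) H := by
  ext1 σ
  rw [map_add]
  simp only [coeff_lift]
  congr 1
  ext τ
  simp [coeff_leftShift, coeff_substVar_zero]

theorem Rep.decr {f : Frac} {H : UFPS k} (hf : Rep f H) (x : Fin k) :
    Rep (f.decr k (2 * x + 1))
      (lift (fun g => leftShift x (g - substVar x 0 g) + substVar x 0 g) H) := by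
  rw [lift_decr]
  exact (hf.shift x).add (hf.eval₀ x)

theorem coeff_iterate_leftShift (x : Fin k) (n : ℕ) (g : FPS k) (τ : Fin k →₀ ℕ) :
    coeff τ ((leftShift x)^[n] g) = coeff (τ + Finsupp.single x n) g := by
  induction n generalizing τ with
  | zero => simp
  | succ n ih =>
    rw [Function.iterate_succ_apply', coeff_leftShift, ih, add_assoc, ← Finsupp.single_add,
      add_comm 1 n]

/-- This replaces the derivatives in the definition of the guard by shifts, which act on closed
forms. -/
theorem X_pow_mul_iterate_leftShift (x : Fin k) (n : ℕ) (g : FPS k) :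
    X x ^ n * (leftShift x)^[n] g = g - restrictLt x n g := by
  ext τ
  rw [mul_comm, coeff_mul_X_pow, coeff_iterate_leftShift, map_sub, coeff_restrictLt]
  by_cases h : n ≤ τ x
  · rw [if_pos h, if_neg (by omega), tsub_add_cancel_of_le (by simpa [Finsupp.single_le_iff]),
      sub_zero]
  · rw [if_neg h, if_pos (by omega), sub_self]

theorem Rep.iterate_shift {f : Frac} {H : UFPS k} (hf : Rep f H) (x : Fin k) (n : ℕ) :
    Rep ((Frac.shift k (2 * x + 1))^[n] f) (lift ((leftShift x)^[n]) H) := by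
  induction n with
  | zero => exact hf
  | succ n ih =>
    rw [Function.iterate_succ_apply', Function.iterate_succ']
    exact ih.shift x

theorem Rep.ge {f : Frac} {H : UFPS k} (hf : Rep f H) (x : Fin k) (n : ℕ) :
    Rep (f.ge k (2 * x + 1) n) (lift (fun g => g - restrictLt x n g) H) := by
  have h : lift (fun g => g - restrictLt x n g) H =
      wordVal k (List.replicate n (2 * x + 1)) * lift ((leftShift x)^[n]) H := by
    ext1 σ
    rw [wordVal_replicate, letterVal_X, ← map_pow, coeff_C_mul, coeff_lift, coeff_lift,
      X_pow_mul_iterate_leftShift]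
  rw [h]
  exact (hf.iterate_shift x n).scale _

theorem Rep.lt {f : Frac} {H : UFPS k} (hf : Rep f H) (x : Fin k) (n : ℕ) :
    Rep (f.lt k (2 * x + 1) n) (lift (restrictLt x n) H) := by
  have h : lift (restrictLt x n) H = H + -lift (fun g => g - restrictLt x n g) H := by
    ext1 σ
    simp
  rw [h]
  exact hf.add (hf.ge x n).neg

end
end ReDiP

namespace ReDiP

/-! ### Marginalisation -/

section
open MvPowerSeries
variable {k : ℕ}

/-- All members of the family have summable coefficients. -/
def Summing (H : UFPS k) : Prop := ∀ σ, Summable fun τ => coeff τ (coeff σ H)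

theorem add_single_injective (x : Fin k) (τ : Fin k →₀ ℕ) :
    Function.Injective fun j : ℕ => τ + Finsupp.single x j := fun _ _ h =>
  Finsupp.single_injective x (add_left_cancel h)

theorem coeff_X_mul (x : Fin k) {R : Type} [CommRing R] (g : MvPowerSeries (Fin k) R)
    (τ : Fin k →₀ ℕ) :
    coeff τ (X x * g) = if 1 ≤ τ x then coeff (τ - Finsupp.single x 1) g else 0 := by
  rw [X_def, coeff_monomial_mul]
  simp [Finsupp.single_le_iff]

theorem summable_X_mul (x : Fin k) {g : FPS k} (hg : Summable fun τ => coeff τ g) :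
    Summable fun τ => coeff τ (X x * g) := by
  have hi : Function.Injective fun τ : Fin k →₀ ℕ => τ + Finsupp.single x 1 :=
    add_left_injective _
  rw [← hi.summable_iff]
  · refine hg.congr fun τ => ?_
    simp [coeff_X_mul]
  · intro τ hτ
    rw [coeff_X_mul, if_neg]
    intro h
    exact hτ ⟨τ - Finsupp.single x 1, tsub_add_cancel_of_le (by simpa [Finsupp.single_le_iff])⟩

theorem Summing.letterVal_mul {H : UFPS k} (hH : Summing H) (i : ℕ) :
    Summing (letterVal k i * H) := by
  intro σ
  rcases letterVal_cases (k := k) i with rfl | ⟨y, rfl⟩ | ⟨y, rfl⟩ | ⟨-, h0⟩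
  · simpa using (hH σ).neg
  · rw [letterVal_X, coeff_C_mul]
    exact summable_X_mul y (hH σ)
  · rw [letterVal_U, coeff_X_mul]
    split_ifs
    · exact hH _
    · simp
  · rw [h0, zero_mul]; simp

theorem Summing.add {H G : UFPS k} (hH : Summing H) (hG : Summing G) : Summing (H + G) :=
  fun σ => by simpa using (hH σ).add (hG σ)

theorem Summing.wordVal_mul {H : UFPS k} (hH : Summing H) (w : List ℕ) :
    Summing (wordVal k w * H) := by
  induction w with
  | nil => simpa using hH
  | cons i w ih => rw [wordVal_cons, mul_assoc]; exact ih.letterVal_mul i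

theorem summing_zero : Summing (0 : UFPS k) := fun σ => by simp

theorem summing_one : Summing (1 : UFPS k) := by
  classical
  intro σ
  rw [coeff_one]
  split_ifs
  · refine summable_of_ne_finset_zero (s := {0}) fun τ hτ => ?_
    rw [coeff_one, if_neg (by simpa using hτ)]
  · simp

theorem Summing.polyVal_mul {H : UFPS k} (hH : Summing H) (F : WPoly) :
    Summing (polyVal k F * H) := by
  induction F with
  | nil => simpa using summing_zero
  | cons w F ih => rw [polyVal_cons, add_mul]; exact (hH.wordVal_mul w).add ih

theorem substOne_zero (x : Fin k) : substOne x (0 : FPS k) = 0 := by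
  ext τ; simp [coeff_substOne]

theorem substOne_neg (x : Fin k) (g : FPS k) : substOne x (-g) = -substOne x g := by
  ext τ
  rw [map_neg, coeff_substOne, coeff_substOne]
  split_ifs <;> simp [tsum_neg]

theorem substOne_add (x : Fin k) {f g : FPS k} (hf : Summable fun τ => coeff τ f)
    (hg : Summable fun τ => coeff τ g) : substOne x (f + g) = substOne x f + substOne x g := by
  ext τ
  rw [map_add, coeff_substOne, coeff_substOne, coeff_substOne]
  split_ifs
  · simp only [map_add]
    exact (hf.comp_injective (add_single_injective x τ)).tsum_add
      (hg.comp_injective (add_single_injective x τ))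
  · simp

theorem substOne_X_mul_self (x : Fin k) {g : FPS k} (hg : Summable fun τ => coeff τ g) :
    substOne x (X x * g) = substOne x g := by
  ext τ
  rw [coeff_substOne, coeff_substOne]
  split_ifs with h
  · have hs := (summable_X_mul x hg).comp_injective (add_single_injective x τ)
    -- The term `j = 0` of the series for X g vanishes, and the others are the series for `g` moved
    -- by one place.
    have h0 := hs.tsum_eq_zero_add
    simp only [Function.comp_def] at h0
    rw [h0, coeff_X_mul, if_neg (by simp [h]), zero_add]
    refine tsum_congr fun j => ?_
    rw [coeff_X_mul, if_pos (by simp; omega), Finsupp.single_add, ← add_assoc, add_tsub_cancel_right]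
  · rfl

theorem substOne_X_mul {x y : Fin k} (hy : y ≠ x) (g : FPS k) :
    substOne x (X y * g) = X y * substOne x g := by
  ext τ
  rw [coeff_X_mul, coeff_substOne]
  by_cases hx : τ x = 0
  · rw [if_pos hx]
    by_cases h : 1 ≤ τ y
    · rw [if_pos h, coeff_substOne, if_pos (by simp [hx])]
      refine tsum_congr fun j => ?_
      rw [coeff_X_mul, if_pos (by simp; omega)]
      congr 2
      rw [tsub_add_eq_add_tsub]
      simpa [Finsupp.single_le_iff] using h
    · rw [if_neg h]
      refine (tsum_congr fun j => ?_).trans tsum_zero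
      rw [coeff_X_mul, if_neg (by simp [hy.symm]; omega)]
  · rw [if_neg hx]
    split_ifs
    · rw [coeff_substOne, if_neg (by simp [hy, hx])]
    · rfl

theorem lift_substOne_letterVal_mul_self (x : Fin k) {H : UFPS k} (hH : Summing H) :
    lift (substOne x) (letterVal k (2 * (x : ℕ) + 1) * H) = lift (substOne x) H := by
  ext1 σ
  rw [coeff_lift, coeff_lift, letterVal_X, coeff_C_mul, substOne_X_mul_self x (hH σ)]

theorem lift_substOne_letterVal_mul {x : Fin k} {i : ℕ} (hi : i ≠ 2 * (x : ℕ) + 1) (H : UFPS k) :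
    lift (substOne x) (letterVal k i * H) = letterVal k i * lift (substOne x) H := by
  ext1 σ
  rw [coeff_lift]
  rcases letterVal_cases (k := k) i with rfl | ⟨y, rfl⟩ | ⟨y, rfl⟩ | ⟨-, h0⟩
  · simp [substOne_neg]
  · have hy : y ≠ x := by rintro rfl; exact hi rfl
    rw [letterVal_X, coeff_C_mul, coeff_C_mul, substOne_X_mul hy, coeff_lift]
  · rw [letterVal_U, coeff_X_mul, coeff_X_mul]
    split_ifs
    · rfl
    · exact substOne_zero x
  · simp [h0, substOne_zero]

theorem lift_substOne_wordVal_mul (x : Fin k) {H : UFPS k} (hH : Summing H) (w : List ℕ) :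
    lift (substOne x) (wordVal k w * H) =
      wordVal k (WPoly.strip (2 * x + 1) w) * lift (substOne x) H := by
  induction w with
  | nil => simp [WPoly.strip]
  | cons i w ih =>
    rw [wordVal_cons, mul_assoc]
    by_cases hi : i = 2 * (x : ℕ) + 1
    · subst hi
      rw [lift_substOne_letterVal_mul_self x (hH.wordVal_mul w), ih]
      simp [WPoly.strip]
    · rw [lift_substOne_letterVal_mul hi, ih, ← mul_assoc, ← wordVal_cons]
      simp [WPoly.strip, hi]

/-- Evaluation at 1 sums infinite series and is not a ring homomorphism on all power series. Letter
by letter, however, it commutes with multiplication of a summable family by a polynomial. -/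
theorem lift_substOne_polyVal_mul (x : Fin k) {H : UFPS k} (hH : Summing H) (F : WPoly) :
    lift (substOne x) (polyVal k F * H) =
      polyVal k (WPoly.rem₁ (2 * x + 1) F) * lift (substOne x) H := by
  induction F with
  | nil =>
    ext1 σ
    simp [WPoly.rem₁, substOne_zero]
  | cons w F ih =>
    have h : lift (substOne x) (wordVal k w * H + polyVal k F * H) =
        lift (substOne x) (wordVal k w * H) + lift (substOne x) (polyVal k F * H) := by
      ext1 σ
      rw [map_add, coeff_lift, coeff_lift, coeff_lift, map_add,
        substOne_add x (hH.wordVal_mul w σ) (hH.polyVal_mul F σ)]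
    rw [polyVal_cons, add_mul, h, ih, lift_substOne_wordVal_mul x hH]
    simp [WPoly.rem₁, add_mul]

theorem substOne_one (x : Fin k) : substOne x (1 : FPS k) = 1 := by
  classical
  ext τ
  rw [coeff_substOne, coeff_one]
  by_cases h : τ = 0
  · subst h
    rw [if_pos (by simp), if_pos rfl, tsum_eq_single 0]
    · simp
    · intro j hj
      rw [coeff_one, if_neg]
      simpa using hj
  · rw [if_neg h]
    split_ifs
    · refine (tsum_congr fun j => ?_).trans tsum_zero
      rw [coeff_one, if_neg]
      intro h'
      exact h (add_eq_zero.mp h').1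
    · rfl

theorem lift_substOne_one (x : Fin k) : lift (substOne x) (1 : UFPS k) = 1 := by
  classical
  ext1 σ
  rw [coeff_lift, coeff_one]
  split_ifs
  · exact substOne_one x
  · exact substOne_zero x

theorem rem₁_mul_lift {x : Fin k} {H : UFPS k} (hH : Summing H) {N Q : WPoly}
    (h : polyVal k Q * H = polyVal k N) :
    polyVal k (WPoly.rem₁ (2 * x + 1) Q) * lift (substOne x) H =
      polyVal k (WPoly.rem₁ (2 * x + 1) N) := by
  -- The numerator is evaluated as its product with the summable family 1.
  have := lift_substOne_polyVal_mul x (summing_one (k := k)) N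
  rw [← lift_substOne_polyVal_mul x hH, h, ← mul_one (polyVal k N), this, lift_substOne_one,
    mul_one]

theorem letterVal_X_sub_one_ne_zero (x : Fin k) : letterVal k (2 * (x : ℕ) + 1) - 1 ≠ 0 := by
  rw [letterVal_X, ← map_one C, ← map_sub, ← map_zero C]
  intro h
  have := congrArg (coeff 0) (C_injective h)
  simp at this

theorem Rep.eval₁ {f : Frac} {H : UFPS k} (hf : Rep f H) (hH : Summing H) (x : Fin k) :
    Rep (f.eval₁ k (2 * x + 1)) (lift (substOne x) H) := by
  have h := hf.cancel (letterVal_X_sub_one_ne_zero x) (polyVal_div₁ _) (fun _ _ => num_quot₁)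
    (fun _ => quot₁_eq_nil) (fun _ _ => rem₁_mul_lift hH)
  exact ⟨h.1, rem₁_mul_lift hH h.2.2⟩

theorem Rep.assign {f : Frac} {H : UFPS k} (hf : Rep f H) (hH : Summing H) (x : Fin k) (n : ℕ) :
    Rep (f.assign k (2 * x + 1) n) (lift (fun g => substOne x g * X x ^ n) H) := by
  have h : lift (fun g => substOne x g * X x ^ n) H =
      wordVal k (List.replicate n (2 * x + 1)) * lift (substOne x) H := by
    ext1 σ
    rw [wordVal_replicate, letterVal_X, ← map_pow, coeff_C_mul, coeff_lift, coeff_lift, mul_comm]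
  rw [h]
  exact (hf.eval₁ hH x).scale _

end
end ReDiP

namespace ReDiP

/-! ### Sampling -/

section
open MvPowerSeries
variable {k : ℕ}

theorem coeff_monomial_mul_sampleFactor_pow (x : Fin k) (D : DistExpr) (d τ : Fin k →₀ ℕ) (n : ℕ)
    (h : coeff τ (monomial d 1 * sampleFactor x D ^ n) ≠ 0) :
    ∃ j, τ = d + Finsupp.single x j ∧ PowerSeries.coeff j (D.sem ^ n) ≠ 0 := by
  classical
  rw [coeff_monomial_mul, sampleFactor, ← PowerSeries.subst_pow (PowerSeries.HasSubst.X x),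
    PowerSeries.coeff_subst_single] at h
  split_ifs at h with h1 h2
  · refine ⟨(τ - d) x, ?_, by simpa using h⟩
    rw [← h2, add_tsub_cancel_of_le h1]
  · simp at h
  · simp at h

theorem coeff_monomial_mul_sampleFactor_pow_add_single (x : Fin k) (D : DistExpr)
    (d : Fin k →₀ ℕ) (n j : ℕ) :
    coeff (d + Finsupp.single x j) (monomial d 1 * sampleFactor x D ^ n) =
      PowerSeries.coeff j (D.sem ^ n) := by
  classical
  rw [coeff_monomial_mul, sampleFactor, ← PowerSeries.subst_pow (PowerSeries.HasSubst.X x),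
    PowerSeries.coeff_subst_single, if_pos (by simp), if_pos (by simp)]
  simp

/-- Let `m` be the order of D and `d₀` an exponent of `g` with least value at `x`. The lowest term
of D^(d₀ y) moves `d₀` to `d₀ + single x (m * d₀ y)`, and by minimality no other exponent of `g`
contributes to that coefficient. -/
theorem substVar_sampleFactor_ne_zero (x y : Fin k) {D : DistExpr} (hD : D.sem ≠ 0) {g : FPS k}
    (hg : g ≠ 0) : substVar y (X y * sampleFactor x D) g ≠ 0 := by
  obtain ⟨m, E, hE, hDE⟩ : ∃ (m : ℕ) (E : PowerSeries ℝ), PowerSeries.constantCoeff E ≠ 0 ∧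
      D.sem = PowerSeries.X ^ m * E := by
    refine ⟨D.sem.order.toNat, PowerSeries.divXPowOrder D.sem, ?_, ?_⟩
    · rwa [Ne, PowerSeries.constantCoeff_divXPowOrder_eq_zero_iff]
    · exact (PowerSeries.X_pow_order_mul_divXPowOrder).symm
  have hpow : ∀ n j, PowerSeries.coeff j (D.sem ^ n) =
      if m * n ≤ j then PowerSeries.coeff (j - m * n) (E ^ n) else 0 := by
    intro n j
    rw [hDE, mul_pow, ← pow_mul, PowerSeries.coeff_X_pow_mul']
  obtain ⟨d₀, hd₀, hmin⟩ : ∃ d₀, coeff d₀ g ≠ 0 ∧ ∀ d, coeff d g ≠ 0 → d₀ x ≤ d x := by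
    obtain ⟨d, hd⟩ := (ne_zero_iff_exists_coeff_ne_zero g).mp hg
    have hne : ∃ n, ∃ d, coeff d g ≠ 0 ∧ d x = n := ⟨_, d, hd, rfl⟩
    classical
    obtain ⟨d₀, h₀, hx⟩ := Nat.find_spec hne
    exact ⟨d₀, h₀, fun d hd => hx ▸ Nat.find_min' hne ⟨d, hd, rfl⟩⟩
  intro h0
  have := coeff_iid x y D g (d₀ + Finsupp.single x (m * d₀ y))
  rw [h0, map_zero, finsum_eq_single _ d₀, coeff_monomial_mul_sampleFactor_pow_add_single, hpow,
    if_pos le_rfl, Nat.sub_self, PowerSeries.coeff_zero_eq_constantCoeff_apply, map_pow] at this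
  · exact mul_ne_zero hd₀ (pow_ne_zero _ hE) this.symm
  · intro d hd
    by_contra hne
    obtain ⟨hdg, hc⟩ := mul_ne_zero_iff.mp hne
    obtain ⟨j, hj, hcj⟩ := coeff_monomial_mul_sampleFactor_pow x D d _ _ hc
    rw [hpow] at hcj
    have hle : m * d y ≤ j := by by_contra h; simp [h] at hcj
    have hother : ∀ i, i ≠ x → d₀ i = d i := by
      intro i hi
      simpa [Finsupp.single_apply, hi.symm] using DFunLike.congr_fun hj i
    have hxx : d₀ x + m * d₀ y = d x + j := by simpa using DFunLike.congr_fun hj x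
    have h1 := hmin d hdg
    have h2 : d x ≤ d₀ x := by
      -- For `y = x` the bound reads (m + 1) * d x ≤ (m + 1) * d₀ x; otherwise `d y = d₀ y`, and the
      -- shifts by at least `m * d₀ y` are compared.
      by_cases hxy : y = x
      · subst hxy; nlinarith
      · rw [hother y hxy] at hxx; omega
    refine hd (Finsupp.ext fun i => ?_)
    by_cases hi : i = x
    · subst hi; omega
    · exact (hother i hi).symm

theorem lift_substVar_sampleFactor_ne_zero (x y : Fin k) {D : DistExpr} (hD : D.sem ≠ 0)
    {H : UFPS k} (hH : H ≠ 0) : lift (substVar y (X y * sampleFactor x D)) H ≠ 0 := by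
  obtain ⟨σ, hσ⟩ := (ne_zero_iff_exists_coeff_ne_zero H).mp hH
  intro h
  refine substVar_sampleFactor_ne_zero x y hD hσ ?_
  rw [← coeff_lift (substVar y _), h, map_zero]

/-- A word with n letters Y receives P^n Q^(M-n), hence the bound n ≤ `M`. The same `M` serves the
numerator and the denominator, so Q^M cancels in the fraction. -/
theorem polyVal_homSubst {x y : Fin k} {D : DistExpr} {d : Frac}
    (hd : polyVal k d.2 * C (sampleFactor x D) = polyVal k d.1) {M : ℕ} {F : WPoly}
    (hM : ∀ w ∈ F, WPoly.num (2 * y + 1) w ≤ M) :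
    polyVal k (WPoly.homSubst (2 * y + 1) d.1 d.2 M F) =
      polyVal k d.2 ^ M * lift (substVar y (X y * sampleFactor x D)) (polyVal k F) := by
  rw [← substHom_apply y _ (constantCoeff_X_mul_sampleFactor x y D)]
  induction F with
  | nil => simp [WPoly.homSubst]
  | cons w F ih =>
    have h1 : WPoly.homSubst (2 * y + 1) d.1 d.2 M (w :: F) =
      WPoly.mul [w] (WPoly.mul (WPoly.pow d.1 (WPoly.num (2 * y + 1) w))
        (WPoly.pow d.2 (M - WPoly.num (2 * y + 1) w))) ++
      WPoly.homSubst (2 * y + 1) d.1 d.2 M F := rfl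
    rw [h1, polyVal_append, ih fun v hv => hM v (List.mem_cons_of_mem _ hv), polyVal_cons, map_add,
      mul_add, substHom_wordVal, map_mul, mul_pow, ← letterVal_X, ← mul_assoc (wordVal k _),
      ← wordVal_strip]
    congr 1
    obtain ⟨r, hr⟩ := Nat.exists_eq_add_of_le (hM w (by simp))
    rw [hr, Nat.add_sub_cancel_left]
    simp only [polyVal_mul, polyVal_pow, polyVal_cons, polyVal_nil, ← hd]
    ring

theorem Rep.subst {f d : Frac} {H : UFPS k} (hf : Rep f H) {x y : Fin k} {D : DistExpr}
    (hd : Rep d (C (sampleFactor x D))) :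
    Rep (f.subst k (2 * y + 1) d) (lift (substVar y (X y * sampleFactor x D)) H) := by
  -- For D = 0 the substitution is Y = 0, which can annihilate the denominator, so the cancelling
  -- evaluation is used.
  by_cases h0 : polyVal k d.1 = 0
  · rw [Frac.subst, if_pos (by rwa [isZero_iff])]
    have h1 : sampleFactor x D = 0 := by
      have := hd.2
      rw [h0, mul_eq_zero, or_iff_right hd.1, ← map_zero C] at this
      exact C_injective this
    rw [h1, mul_zero]
    exact hf.eval₀ y
  · rw [Frac.subst, if_neg (by rwa [isZero_iff])]
    have hsem : D.sem ≠ 0 := by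
      intro h
      refine h0 ?_
      rw [← hd.2, sampleFactor, h, ← PowerSeries.coe_substAlgHom (PowerSeries.HasSubst.X x)]
      simp
    have hM1 : ∀ w ∈ f.1, WPoly.num (2 * y + 1) w ≤ f.1.flatten.length + f.2.flatten.length :=
      fun w hw => (num_le_length _ hw).trans (Nat.le_add_right _ _)
    have hM2 : ∀ w ∈ f.2, WPoly.num (2 * y + 1) w ≤ f.1.flatten.length + f.2.flatten.length :=
      fun w hw => (num_le_length _ hw).trans (Nat.le_add_left _ _)
    refine ⟨?_, ?_⟩
    · simp only
      rw [polyVal_homSubst hd.2 hM2]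
      exact mul_ne_zero (pow_ne_zero _ hd.1) (lift_substVar_sampleFactor_ne_zero x y hsem hf.1)
    · simp only
      rw [polyVal_homSubst hd.2 hM1, polyVal_homSubst hd.2 hM2, ← hf.2, mul_assoc]
      congr 1
      simp only [← substHom_apply _ _ (constantCoeff_X_mul_sampleFactor x y D)]
      rw [map_mul]

/-! ### Closed forms of distributions -/

/-- The natural number by which an integer is encoded. -/
def intCode (z : ℤ) : ℕ := Encodable.encode z

/-- The code of an integer is 2n for n ≥ 0 and 2n + 1 for -(n + 1), so its parity gives the sign. -/
def WPoly.ofInt (c m : ℕ) (w : List ℕ) : WPoly :=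
  if c % 2 = 0 then List.replicate (c / 2 * m) w else List.replicate ((c / 2 + 1) * m) (0 :: w)

/-- The polynomial in the letter `a` with the given coefficients, multiplied by `L`. -/
def WPoly.ofCoeffs (a L : ℕ) (l : List (ℕ × ℕ)) : WPoly :=
  (List.range l.length).flatMap fun i =>
    WPoly.ofInt (l.getD i (0, 1)).1 (L / (l.getD i (0, 1)).2) (List.replicate i a)

def commonDen (l : List (ℕ × ℕ)) : ℕ := l.foldr (fun q r => q.2 * r) 1

/-- The same multiple clears the denominators of both lists, so the quotient is unchanged. -/
def Frac.ofDist (a : ℕ) (l m : List (ℕ × ℕ)) : Frac :=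
  (WPoly.ofCoeffs a (commonDen (l ++ m)) l, WPoly.ofCoeffs a (commonDen (l ++ m)) m)

def ratCode (q : ℚ) : ℕ × ℕ := (intCode q.num, q.den)

theorem polyVal_ofInt (z : ℤ) (m : ℕ) (w : List ℕ) :
    polyVal k (WPoly.ofInt (intCode z) m w) = ((z : ℤ) : UFPS k) * m * wordVal k w := by
  rcases z with n | n
  · have h : intCode (Int.ofNat n) = 2 * n := rfl
    rw [h, WPoly.ofInt, if_pos (by omega), polyVal_replicate]
    simp
  · have h : intCode (Int.negSucc n) = 2 * n + 1 := rfl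
    have h' : (2 * n + 1) / 2 = n := by omega
    have h'' : ¬ (2 * n + 1) % 2 = 0 := by omega
    rw [h, WPoly.ofInt, if_neg h'', h', polyVal_replicate]
    simp [Int.negSucc_eq]
    ring

theorem dvd_commonDen {l : List (ℕ × ℕ)} {q : ℕ × ℕ} (hq : q ∈ l) : q.2 ∣ commonDen l := by
  induction l with
  | nil => simp at hq
  | cons r l ih =>
    rcases List.mem_cons.mp hq with rfl | h
    · exact Dvd.intro _ rfl
    · exact (ih h).mul_left _

theorem commonDen_ne_zero {l : List (ℕ × ℕ)} (h : ∀ q ∈ l, q.2 ≠ 0) : commonDen l ≠ 0 := by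
  induction l with
  | nil => simp [commonDen]
  | cons r l ih =>
    exact mul_ne_zero (h r (by simp)) (ih fun q hq => h q (List.mem_cons_of_mem _ hq))

theorem listSeries_eq_sum (l : List ℚ) : listSeries l =
    ∑ i ∈ Finset.range l.length, PowerSeries.C ((l.getD i 0 : ℚ) : ℝ) * PowerSeries.X ^ i := by
  ext n
  rw [map_sum, listSeries, PowerSeries.coeff_mk]
  simp only [PowerSeries.coeff_C_mul, PowerSeries.coeff_X_pow, mul_ite, mul_one, mul_zero,
    Finset.sum_ite_eq, Finset.mem_range]
  split_ifs with h
  · rfl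
  · rw [List.getD_eq_default _ _ (not_lt.mp h)]; simp

theorem subst_listSeries (x : Fin k) (l : List ℚ) :
    PowerSeries.subst (X x : FPS k) (listSeries l) =
      ∑ i ∈ Finset.range l.length, C ((l.getD i 0 : ℚ) : ℝ) * X x ^ i := by
  rw [listSeries_eq_sum, ← PowerSeries.coe_substAlgHom (PowerSeries.HasSubst.X x), map_sum]
  refine Finset.sum_congr rfl fun i _ => ?_
  rw [map_mul, map_pow, PowerSeries.substAlgHom_X, PowerSeries.coe_substAlgHom,
    PowerSeries.subst_C]

theorem polyVal_ofCoeffs (x : Fin k) (l : List ℚ) {L : ℕ} (hL : ∀ q ∈ l, q.den ∣ L) :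
    polyVal k (WPoly.ofCoeffs (2 * x + 1) L (l.map ratCode)) =
      (L : UFPS k) * C (PowerSeries.subst (X x : FPS k) (listSeries l)) := by
  rw [WPoly.ofCoeffs, polyVal_flatMap, List.length_map, subst_listSeries, map_sum, Finset.mul_sum]
  change ∑ i ∈ Finset.range l.length, _ = _
  refine Finset.sum_congr rfl fun i hi => ?_
  have hi' := Finset.mem_range.mp hi
  have hget : (l.map ratCode).getD i (0, 1) = ratCode (l.getD i 0) := by
    rw [List.getD_eq_getElem _ _ (by simpa using hi'), List.getD_eq_getElem _ _ hi',
      List.getElem_map]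
  have hdvd := hL (l.getD i 0) (by rw [List.getD_eq_getElem _ _ hi']; exact List.getElem_mem hi')
  rw [hget]
  generalize l.getD i 0 = q at *
  obtain ⟨m, rfl⟩ := hdvd
  have hz : ((q.num : ℤ) : UFPS k) = (q.den : UFPS k) * C (C ((q : ℚ) : ℝ)) := by
    rw [← map_natCast (C (σ := Fin k) (R := FPS k)), ← map_natCast (C (σ := Fin k) (R := ℝ)),
      ← map_mul, ← map_mul, ← map_intCast (C (σ := Fin k) (R := FPS k)),
      ← map_intCast (C (σ := Fin k) (R := ℝ))]
    congr 2
    exact_mod_cast (Rat.den_mul_eq_num q).symm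
  simp only [ratCode]
  rw [polyVal_ofInt, Nat.mul_div_cancel_left _ q.pos, wordVal_replicate, letterVal_X, hz, map_mul,
    map_pow, Nat.cast_mul]
  ring

theorem natCast_ne_zero {n : ℕ} (hn : n ≠ 0) : (n : UFPS k) ≠ 0 := by
  rw [← map_natCast (C (σ := Fin k) (R := FPS k)), ← map_natCast (C (σ := Fin k) (R := ℝ)),
    ← map_zero C, ← map_zero C]
  intro h
  exact Nat.cast_ne_zero.mpr hn (C_injective (C_injective h))

theorem rep_ofDist (x : Fin k) {D : DistExpr} (hD : D.Valid) :
    Rep (Frac.ofDist (2 * x + 1) (D.num.map ratCode) (D.den.map ratCode))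
      (C (sampleFactor x D)) := by
  have hL : ∀ q ∈ D.num ++ D.den, q.den ∣ commonDen (D.num.map ratCode ++ D.den.map ratCode) := by
    intro q hq
    rw [← List.map_append]
    exact dvd_commonDen (List.mem_map_of_mem (f := ratCode) hq)
  have hL0 : commonDen (D.num.map ratCode ++ D.den.map ratCode) ≠ 0 := by
    rw [← List.map_append]
    refine commonDen_ne_zero fun q hq => ?_
    obtain ⟨r, -, rfl⟩ := List.mem_map.mp hq
    exact r.den_nz
  have h1 := polyVal_ofCoeffs x D.num fun q hq => hL q (List.mem_append_left _ hq)
  have h2 := polyVal_ofCoeffs x D.den fun q hq => hL q (List.mem_append_right _ hq)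
  rw [Rep, Frac.ofDist]
  simp only [h1, h2]
  have hden : PowerSeries.constantCoeff (listSeries D.den) ≠ 0 := hD.1
  have hmul : listSeries D.den * D.sem = listSeries D.num := by
    rw [DistExpr.sem, mul_left_comm, PowerSeries.mul_inv_cancel _ hden, mul_one]
  refine ⟨mul_ne_zero (natCast_ne_zero hL0) ?_, ?_⟩
  -- The constant coefficient of the denominator survives the substitution and is nonzero by
  -- validity.
  · rw [← map_zero C]
    intro h
    have h0 := congrArg (coeff 0) (C_injective h)
    rw [PowerSeries.coeff_subst_single] at h0
    simp at h0
    exact hden h0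
  · rw [mul_assoc, ← map_mul, sampleFactor, ← PowerSeries.subst_mul (PowerSeries.HasSubst.X x), hmul]

theorem Rep.iid {f : Frac} {H : UFPS k} (hf : Rep f H) (x y : Fin k) {D : DistExpr}
    (hD : D.Valid) :
    Rep (f.subst k (2 * y + 1) (Frac.ofDist (2 * x + 1) (D.num.map ratCode) (D.den.map ratCode)))
      (lift (substVar y (X y * sampleFactor x D)) H) :=
  hf.subst (rep_ofDist x hD)

end
end ReDiP

namespace ReDiP

/-! ### Execution of programs on closed forms -/

def decodeCoeffs (c : ℕ) : List (ℕ × ℕ) := (Encodable.decode c).getD []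

/-- An integer and its natural number code are encoded alike, so the algorithm can read rationals as
pairs of natural numbers. -/
theorem decodeCoeffs_codeList (l : List ℚ) : decodeCoeffs (codeList l) = l.map ratCode := by
  have h : codeList l = Encodable.encode (l.map ratCode) := by
    induction l with
    | nil => rfl
    | cons q l ih =>
      rw [codeList, List.map_cons, Encodable.encode_list_cons, List.map_cons,
        Encodable.encode_list_cons, ← ih]
      rfl
  rw [decodeCoeffs, h, Encodable.encodek]
  rfl

namespace Frac

/-- The letter of the indeterminate of a program variable. -/
def varLetter (x : ℕ) : ℕ := 2 * x + 1

def iid (k x y c : ℕ) (f : Frac) : Frac :=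
  f.subst k (varLetter y)
    (ofDist (varLetter x) (decodeCoeffs c.unpair.1) (decodeCoeffs c.unpair.2))

/-- One instruction of a machine that works on a stack of closed forms: the instructions `0`, `1`
and `2` transform the top of the stack, `3` splits it by a guard, `4` exchanges the two topmost
entries and all others add them. -/
def exec (k : ℕ) (s : List Frac) (c : ℕ × ℕ) : List Frac :=
  if c.1 = 0 then s.headI.assign k (varLetter c.2.unpair.1) c.2.unpair.2 :: s.tail
  else if c.1 = 1 then s.headI.decr k (varLetter c.2) :: s.tail
  else if c.1 = 2 then
    s.headI.iid k c.2.unpair.1 c.2.unpair.2.unpair.2 c.2.unpair.2.unpair.1 :: s.tail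
  else if c.1 = 3 then
    s.headI.lt k (varLetter c.2.unpair.1) c.2.unpair.2 ::
      s.headI.ge k (varLetter c.2.unpair.1) c.2.unpair.2 :: s.tail
  else if c.1 = 4 then s.tail.headI :: s.headI :: s.tail.tail
  else s.headI.add s.tail.headI :: s.tail.tail

def run (k : ℕ) (l : List (ℕ × ℕ)) (s : List Frac) : List Frac := l.foldl (exec k) s

end Frac

/-- Translation into stack instructions of the code `l.length`, given the translations `l` of all
smaller codes. -/
def compileStep (l : List (List (ℕ × ℕ))) : List (ℕ × ℕ) :=
  if l.length.unpair.1 ≤ 2 then [l.length.unpair]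
  else if l.length.unpair.1 = 3 then
    (3, l.length.unpair.2.unpair.1) :: (l.getD l.length.unpair.2.unpair.2.unpair.1 [] ++
      ((4, 0) :: (l.getD l.length.unpair.2.unpair.2.unpair.2 [] ++ [(5, 0)])))
  else l.getD l.length.unpair.2.unpair.1 [] ++ l.getD l.length.unpair.2.unpair.2 []

/-- Course-of-values recursion on codes. Only instruction lists are tabulated; closed forms, which
change along the recursion through a program, enter later in the fold `Frac.run`. -/
def compileTable (n : ℕ) : List (List (ℕ × ℕ)) :=
  Nat.rec [] (fun _ l => l ++ [compileStep l]) n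

def compile (n : ℕ) : List (ℕ × ℕ) := compileStep (compileTable n)

theorem compileTable_eq (n : ℕ) : compileTable n = (List.range n).map compile := by
  induction n with
  | zero => rfl
  | succ n ih =>
    rw [List.range_succ, List.map_append, ← ih]
    rfl

theorem getD_compileTable {m n : ℕ} (h : m < n) : (compileTable n).getD m [] = compile m := by
  rw [compileTable_eq, List.getD_eq_getElem _ _ (by simpa using h)]
  simp

theorem compile_eq (n : ℕ) : compile n =
    if n.unpair.1 ≤ 2 then [n.unpair]
    else if n.unpair.1 = 3 then
      (3, n.unpair.2.unpair.1) :: (compile n.unpair.2.unpair.2.unpair.1 ++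
        ((4, 0) :: (compile n.unpair.2.unpair.2.unpair.2 ++ [(5, 0)])))
    else compile n.unpair.2.unpair.1 ++ compile n.unpair.2.unpair.2 := by
  have hl : (compileTable n).length = n := by rw [compileTable_eq]; simp
  conv_lhs => rw [compile, compileStep, hl]
  by_cases h : n.unpair.1 ≤ 2
  · rw [if_pos h, if_pos h]
  · have h0 : n.unpair.2 < n := by
      -- A pair is at least the sum of its components, and the tag is positive here.
      conv_rhs => rw [← Nat.pair_unpair n]
      exact (Nat.add_le_pair _ _).trans_lt' (by omega)
    have h1 := Nat.unpair_left_le n.unpair.2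
    have h2 := Nat.unpair_right_le n.unpair.2
    have h3 := Nat.unpair_left_le n.unpair.2.unpair.2
    have h4 := Nat.unpair_right_le n.unpair.2.unpair.2
    rw [if_neg h, if_neg h, getD_compileTable (by omega), getD_compileTable (by omega),
      getD_compileTable (by omega), getD_compileTable (by omega)]

/-! ### Correctness of compiled programs. -/

section
open MvPowerSeries
variable {k : ℕ}

theorem Frac.run_append (l m : List (ℕ × ℕ)) (s : List Frac) :
    Frac.run k (l ++ m) s = Frac.run k m (Frac.run k l s) := List.foldl_append

theorem summing_of_isPGF {H : UFPS k} (hH : ∀ σ, IsPGF (coeff σ H)) : Summing H :=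
  fun σ => (hH σ).2.1

/-- The stack below the top is arbitrary, so the untreated branch or the finished result of a
conditional survives the run of the other branch. The PGF hypothesis supplies the summability that
assignments need. -/
theorem run_compile {P : Prog k} (hf : P.LoopFree) (hv : P.Valid) {f : Frac} {H : UFPS k}
    (hH : ∀ σ, IsPGF (coeff σ H)) (hfH : Rep f H) (s : List Frac) :
    ∃ g, Frac.run k (compile P.code) (f :: s) = g :: s ∧ Rep g (lift P.sem H) := by
  induction P generalizing f H s with
  | assign x n =>
    refine ⟨_, ?_, hfH.assign (summing_of_isPGF hH) x n⟩
    rw [compile_eq]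
    simp [Prog.code, Frac.run, Frac.exec, Frac.varLetter]
  | decr x =>
    refine ⟨_, ?_, hfH.decr x⟩
    rw [compile_eq]
    simp [Prog.code, Frac.run, Frac.exec, Frac.varLetter]
  | iid x D y =>
    refine ⟨_, ?_, hfH.iid x y hv⟩
    rw [compile_eq]
    simp [Prog.code, Frac.run, Frac.exec, Frac.varLetter, Frac.iid, decodeCoeffs_codeList]
  | ite x n P Q ihP ihQ =>
    obtain ⟨g₁, h₁, hg₁⟩ := ihP hf.1 hv.1 (H := lift (restrictLt x n) H)
      (fun σ => (hH σ).restrictLt x n) (hfH.lt x n)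
      (f.ge k (2 * x + 1) n :: s)
    obtain ⟨g₂, h₂, hg₂⟩ := ihQ hf.2 hv.2
      (H := lift (fun g => g - restrictLt x n g) H) (fun σ => (hH σ).sub_restrictLt x n) (hfH.ge x n)
      (g₁ :: s)
    refine ⟨g₂.add g₁, ?_, ?_⟩
    · have h3 : Frac.exec k (f :: s) (3, Nat.pair x n) =
          f.lt k (2 * x + 1) n :: f.ge k (2 * x + 1) n :: s := by
        simp [Frac.exec, Frac.varLetter]
      have h4 : Frac.exec k (g₁ :: f.ge k (2 * x + 1) n :: s) (4, 0) =
          f.ge k (2 * x + 1) n :: g₁ :: s := by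
        simp [Frac.exec]
      have h5 : Frac.exec k (g₂ :: g₁ :: s) (5, 0) = g₂.add g₁ :: s := by
        simp [Frac.exec]
      rw [compile_eq]
      simp only [Prog.code, Nat.unpair_pair]
      rw [if_neg (by omega), if_pos trivial]
      change Frac.run k _ (Frac.exec k _ _) = _
      rw [h3, Frac.run_append, h₁]
      change Frac.run k _ (Frac.exec k _ _) = _
      rw [h4, Frac.run_append, h₂]
      exact h5
    · have := hg₂.add hg₁
      rwa [add_comm] at this
  | seq P Q ihP ihQ =>
    obtain ⟨g₁, h₁, hg₁⟩ := ihP hf.1 hv.1 hH hfH s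
    obtain ⟨g₂, h₂, hg₂⟩ := ihQ hf.2 hv.2 (H := lift P.sem H)
      (fun σ => (Prog.isKernel_sem hf.1 hv.1).isPGF (hH σ)) hg₁ s
    refine ⟨g₂, ?_, hg₂⟩
    rw [compile_eq]
    simp only [Prog.code, Nat.unpair_pair]
    rw [if_neg (by omega), if_neg (by omega), Frac.run_append, h₁, h₂]
  | loop x n P => exact hf.elim

/-! ### The family of all initial states -/

/-- The closed form of the family of the point masses at all states. -/
def Frac.init (k : ℕ) : Frac :=
  ([[]], (List.range k).foldr
    (fun j r => WPoly.mul [[], [0, 2 * j + 1, 2 * j + 2]] r) [[]])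

/-- The members of the family of point masses that are indexed by states vanishing at the
first `m` variables. -/
noncomputable def pointMasses (k m : ℕ) : UFPS k := fun σ =>
  open Classical in if ∀ x : Fin k, (x : ℕ) < m → σ x = 0 then monomial σ 1 else 0

/-- Multiplication by X_x U_x moves the index by one at `x`, so the difference keeps exactly the
members with `σ x = 0`. Iterated over all variables, this leaves the constant family 1. -/
theorem pointMasses_succ (x : Fin k) :
    (1 - C (X x) * X x) * pointMasses k x = pointMasses k (x + 1) := by
  classical
  ext1 σ
  have hcoeff : ∀ m, coeff σ (pointMasses k m) =
    if ∀ y : Fin k, (y : ℕ) < m → σ y = 0 then monomial σ (1 : ℝ) else 0 := fun m => by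
      simp only [pointMasses, coeff_apply]
  have hsucc : (∀ y : Fin k, (y : ℕ) < x + 1 → σ y = 0) ↔
      (∀ y : Fin k, (y : ℕ) < x → σ y = 0) ∧ σ x = 0 := by
    constructor
    · exact fun h => ⟨fun y hy => h y (by omega), h x (by omega)⟩
    · rintro ⟨h1, h2⟩ y hy
      rcases Nat.lt_succ_iff_lt_or_eq.mp hy with h | h
      · exact h1 y h
      · rwa [Fin.ext h]
  rw [sub_mul, one_mul, map_sub, mul_assoc, coeff_C_mul, coeff_X_mul, hcoeff, hcoeff]
  simp only [hsucc]
  by_cases hx : σ x = 0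
  · simp [hx]
  · have hshift : (∀ y : Fin k, (y : ℕ) < x → (σ - Finsupp.single x 1 : Fin k →₀ ℕ) y = 0) ↔
        ∀ y : Fin k, (y : ℕ) < x → σ y = 0 := by
      refine forall₂_congr fun y hy => ?_
      have : x ≠ y := by rintro rfl; omega
      simp [this]
    have hc : coeff (σ - Finsupp.single x 1) (pointMasses k x) =
        if ∀ y : Fin k, (y : ℕ) < x → σ y = 0 then monomial (σ - Finsupp.single x 1) (1 : ℝ)
        else 0 := by
      simp only [pointMasses, coeff_apply]
      exact if_congr hshift rfl rfl
    rw [if_pos (show 1 ≤ σ x by omega), hc, if_neg (fun h : _ ∧ σ x = 0 => hx h.2)]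
    split_ifs
    · rw [X_def, monomial_mul_monomial, add_tsub_cancel_of_le, mul_one, sub_self]
      simp [Finsupp.single_le_iff]; omega
    · simp

theorem polyVal_init (m : ℕ) (hm : m ≤ k) :
    polyVal k ((List.range m).foldr
      (fun j r => WPoly.mul [[], [0, 2 * j + 1, 2 * j + 2]] r) [[]]) * pointMasses k 0 =
      pointMasses k m := by
  have hfold : ∀ (l : List ℕ), polyVal k (l.foldr
      (fun j r => WPoly.mul [[], [0, 2 * j + 1, 2 * j + 2]] r) [[]]) =
      (l.map fun j => 1 - letterVal k (2 * j + 1) * letterVal k (2 * j + 2)).prod := by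
    intro l
    induction l with
    | nil => simp
    | cons j l ih => simp [ih, sub_eq_add_neg]
  rw [hfold]
  induction m with
  | zero => simp
  | succ m ih =>
    have := pointMasses_succ (⟨m, hm⟩ : Fin k)
    rw [List.range_succ, List.map_append, List.prod_append, mul_comm (List.prod _), mul_assoc,
      ih (by omega)]
    have e1 := letterVal_X (⟨m, hm⟩ : Fin k)
    have e2 := letterVal_U (⟨m, hm⟩ : Fin k)
    simp only at e1 e2 this
    simp [e1, e2, this]

theorem coeff_pointMasses_zero (σ : Fin k →₀ ℕ) :
    coeff σ (pointMasses k 0) = monomial σ (1 : ℝ) := by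
  simp [pointMasses, coeff_apply]

theorem pointMasses_self : pointMasses k k = 1 := by
  classical
  ext1 σ
  rw [coeff_one, coeff_apply, pointMasses]
  by_cases h : σ = 0
  · subst h; simp [monomial_zero_one]
  · rw [if_neg h, if_neg]
    intro h'
    exact h (Finsupp.ext fun x => h' x x.2)

theorem rep_init : Rep (Frac.init k) (pointMasses k 0) := by
  have h := polyVal_init k le_rfl
  rw [pointMasses_self] at h
  refine ⟨left_ne_zero_of_mul_eq_one h, ?_⟩
  rw [Frac.init, h]
  simp

/-! ### The decision procedure -/

/-- The closed form of a program. -/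
def closedForm (k c : ℕ) : Frac := (Frac.run k (compile c) [Frac.init k]).headI

def decideEquiv (p : ℕ × ℕ × ℕ) : Bool :=
  decide (WPoly.IsZero p.1
    (WPoly.mul (closedForm p.1 p.2.1).1 (closedForm p.1 p.2.2).2 ++
      WPoly.neg (WPoly.mul (closedForm p.1 p.2.2).1 (closedForm p.1 p.2.1).2)))

theorem rep_closedForm {P : Prog k} (hf : P.LoopFree) (hv : P.Valid) :
    Rep (closedForm k P.code) (lift P.sem (pointMasses k 0)) := by
  obtain ⟨g, hg, h⟩ := run_compile hf hv
    (fun σ => by rw [coeff_pointMasses_zero]; exact isPGF_monomial σ) rep_init []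
  rwa [closedForm, hg]

/-- The denominators are nonzero in a domain, so the cross difference vanishes exactly when the two
families agree. Their coefficients at U^σ are the images of the point masses, to which
`IsKernel.ext` applies. -/
theorem decideEquiv_iff {P Q : Prog k} (hP : P.LoopFree) (hQ : Q.LoopFree) (hP' : P.Valid)
    (hQ' : Q.Valid) : decideEquiv (k, P.code, Q.code) = true ↔ P.Equivalent Q := by
  obtain ⟨p0, hp⟩ := rep_closedForm hP hP'
  obtain ⟨q0, hq⟩ := rep_closedForm hQ hQ'
  rw [decideEquiv, decide_eq_true_iff, isZero_iff]
  simp only [polyVal_append, polyVal_mul, polyVal_neg, ← hp, ← hq]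
  have hfactor : ∀ A B F G : UFPS k, A * F * B + -(B * G * A) = A * B * (F - G) := by
    intros; ring
  rw [hfactor, mul_eq_zero, or_iff_right (mul_ne_zero p0 q0), sub_eq_zero]
  constructor
  · intro h g hg
    refine (Prog.isKernel_sem hP hP').ext (Prog.isKernel_sem hQ hQ') (fun σ => ?_) hg
    have := congrArg (coeff σ) h
    rwa [coeff_lift, coeff_lift, coeff_pointMasses_zero] at this
  · intro h
    ext1 σ
    rw [coeff_lift, coeff_lift, coeff_pointMasses_zero]
    exact h _ (isPGF_monomial σ)

end
end ReDiP

namespace ReDiP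

/-! ### Primitive recursiveness -/

section
open Primrec

variable {α β : Type} [Primcodable α] [Primcodable β]

/-- The predicate may depend on the input: letters, exponents and `k` are all data of the algorithm.
-/
theorem primrec_filter {f : α → List β} {R : α → β → Prop} [∀ a, DecidablePred (R a)]
    (hf : Primrec f) (hR : PrimrecPred fun p : α × β => R p.1 p.2) :
    Primrec fun a => (f a).filter fun b => R a b := by
  have h : Primrec₂ fun (a : α) (b : β) => if R a b then some b else none :=
    Primrec.ite hR (option_some.comp snd) (const none)
  refine (listFilterMap hf h).of_eq fun a => ?_
  rw [← List.filterMap_eq_filter]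
  refine List.filterMap_congr fun b _ => ?_
  by_cases hb : R a b <;> simp [hb, Option.guard]

theorem primrecPred_forall_mem {f : α → List β} {R : α → β → Prop}
    (hf : Primrec f) (hR : PrimrecPred fun p : α × β => R p.1 p.2) :
    PrimrecPred fun a => ∀ b ∈ f a, R a b := by
  have h : PrimrecRel fun (b : β) (a : α) => R a b := hR.comp (snd.pair fst)
  exact h.forall_mem_list.comp hf Primrec.id

theorem primrec_replicate {f : α → ℕ} {g : α → β} (hf : Primrec f) (hg : Primrec g) :
    Primrec fun a => List.replicate (f a) (g a) :=
  (list_map (list_range.comp hf) (hg.comp fst).to₂).of_eq fun a => by simp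

/-! ### Primitive recursiveness of the operations on polynomials. -/

namespace WPoly

theorem primrec_neg : Primrec neg :=
  list_map Primrec.id (list_cons.comp (const 0) snd).to₂

theorem primrec_mul : Primrec₂ mul :=
  list_flatMap fst (list_map (snd.comp fst)
    (list_append.comp (snd.comp fst) snd).to₂).to₂

theorem primrec_pow : Primrec₂ pow :=
  nat_rec' snd (const [[]]) (primrec_mul.comp (fst.comp fst) (snd.comp snd)).to₂

theorem primrec_strip : Primrec₂ strip :=
  primrec_filter (f := fun p : ℕ × List ℕ => p.2) (R := fun p i => i ≠ p.1) snd
    (Primrec.eq.comp snd (fst.comp fst)).not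

theorem primrec_num : Primrec₂ num :=
  list_length.comp (primrec_filter (f := fun p : ℕ × List ℕ => p.2) (R := fun p i => i = p.1) snd
    (Primrec.eq.comp snd (fst.comp fst)))

theorem primrec_rem₀ : Primrec₂ rem₀ :=
  primrec_filter (f := fun p : ℕ × WPoly => p.2) (R := fun p w => num p.1 w = 0) snd
    (Primrec.eq.comp (primrec_num.comp (fst.comp fst) snd) (const 0))

theorem primrec_quot₀ : Primrec₂ quot₀ :=
  list_map (primrec_filter (f := fun p : ℕ × WPoly => p.2) (R := fun p w => num p.1 w ≠ 0) snd
      (Primrec.eq.comp (primrec_num.comp (fst.comp fst) snd) (const 0)).not)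
    (list_append.comp (primrec_strip.comp (fst.comp fst) snd)
      (primrec_replicate (nat_sub.comp (primrec_num.comp (fst.comp fst) snd) (const 1))
        (fst.comp fst))).to₂

theorem primrec_rem₁ : Primrec₂ rem₁ :=
  list_map snd (primrec_strip.comp (fst.comp fst) snd).to₂

theorem primrec_quot₁ : Primrec₂ quot₁ :=
  list_flatMap snd (list_map (list_range.comp (primrec_num.comp (fst.comp fst) snd))
    (list_append.comp (primrec_strip.comp (fst.comp (fst.comp fst)) (snd.comp fst))
      (primrec_replicate snd (fst.comp (fst.comp fst)))).to₂).to₂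

theorem primrec_homSubst {b M : α → ℕ} {P Q F : α → WPoly} (hb : Primrec b) (hP : Primrec P)
    (hQ : Primrec Q) (hM : Primrec M) (hF : Primrec F) :
    Primrec fun a => homSubst (b a) (P a) (Q a) (M a) (F a) := by
  have hn : Primrec fun p : α × List ℕ => num (b p.1) p.2 := primrec_num.comp (hb.comp fst) snd
  exact list_flatMap hF (primrec_mul.comp (list_cons.comp snd (const []))
    (primrec_mul.comp (primrec_pow.comp (hP.comp fst) hn)
      (primrec_pow.comp (hQ.comp fst) (nat_sub.comp (hM.comp fst) hn)))).to₂

theorem primrecPred_proper {k : α → ℕ} {w : α → List ℕ} (hk : Primrec k) (hw : Primrec w) :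
    PrimrecPred fun a => Proper (k a) (w a) :=
  primrecPred_forall_mem hw (nat_le.comp snd (nat_mul.comp (const 2) (hk.comp fst)))

theorem primrecPred_similar {k : α → ℕ} {v w : α → List ℕ} (hk : Primrec k) (hv : Primrec v)
    (hw : Primrec w) : PrimrecPred fun a => Similar (k a) (v a) (w a) := by
  refine (primrecPred_forall_mem (R := fun a i => num (i + 1) (v a) = num (i + 1) (w a))
    (list_range.comp (nat_mul.comp (const 2) hk)) (Primrec.eq.comp
      (primrec_num.comp (succ.comp snd) (hv.comp fst))
      (primrec_num.comp (succ.comp snd) (hw.comp fst)))).of_eq fun a => ?_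
  simp [Similar]

theorem primrec_signCount {k s : α → ℕ} {F : α → WPoly} {w : α → List ℕ} (hk : Primrec k)
    (hF : Primrec F) (hw : Primrec w) (hs : Primrec s) :
    Primrec fun a => signCount (k a) (F a) (w a) (s a) :=
  list_length.comp (primrec_filter
    (R := fun a v => Proper (k a) v ∧ Similar (k a) v (w a) ∧ num 0 v % 2 = s a) hF
    ((primrecPred_proper (hk.comp fst) snd).and
      ((primrecPred_similar (hk.comp fst) snd (hw.comp fst)).and
        (Primrec.eq.comp (nat_mod.comp (primrec_num.comp (const 0) snd) (const 2)) (hs.comp fst)))))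

theorem primrecPred_isZero {k : α → ℕ} {F : α → WPoly} (hk : Primrec k) (hF : Primrec F) :
    PrimrecPred fun a => IsZero (k a) (F a) := by
  refine (primrecPred_forall_mem (R := fun a w => ¬ Proper (k a) w ∨
    signCount (k a) (F a) w 0 = signCount (k a) (F a) w 1) hF
    ((primrecPred_proper (hk.comp fst) snd).not.or (Primrec.eq.comp
      (primrec_signCount (hk.comp fst) (hF.comp fst) snd (const 0))
      (primrec_signCount (hk.comp fst) (hF.comp fst) snd (const 1))))).of_eq fun a => ?_
  simp only [IsZero, imp_iff_not_or]

theorem primrec_ofInt {c m : α → ℕ} {w : α → List ℕ} (hc : Primrec c) (hm : Primrec m)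
    (hw : Primrec w) : Primrec fun a => ofInt (c a) (m a) (w a) := by
  have h2 : Primrec fun a => c a / 2 := nat_div.comp hc (const 2)
  exact Primrec.ite (Primrec.eq.comp (nat_mod.comp hc (const 2)) (const 0))
    (primrec_replicate (nat_mul.comp h2 hm) hw)
    (primrec_replicate (nat_mul.comp (succ.comp h2) hm) (list_cons.comp (const 0) hw))

theorem primrec_ofCoeffs {x L : α → ℕ} {l : α → List (ℕ × ℕ)} (hx : Primrec x) (hL : Primrec L)
    (hl : Primrec l) : Primrec fun a => ofCoeffs (x a) (L a) (l a) := by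
  have hget : Primrec fun p : α × ℕ => (l p.1).getD p.2 (0, 1) :=
    (list_getD (0, 1)).comp (hl.comp fst) snd
  exact list_flatMap (list_range.comp (list_length.comp hl))
    (primrec_ofInt (fst.comp hget) (nat_div.comp (hL.comp fst) (snd.comp hget))
      (primrec_replicate snd (hx.comp fst))).to₂

end WPoly

theorem primrec_commonDen : Primrec commonDen :=
  list_foldr Primrec.id (const 1)
    (nat_mul.comp (snd.comp (fst.comp snd)) (snd.comp snd)).to₂

theorem primrec_decodeCoeffs : Primrec decodeCoeffs :=
  option_getD.comp Primrec.decode (const [])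

/-! ### Primitive recursiveness of the operations on fractions and of the stack machine. -/

namespace Frac
open WPoly

variable {k a : α → ℕ} {f g : α → Frac}

theorem primrec_ofDist {l m : α → List (ℕ × ℕ)} (ha : Primrec a) (hl : Primrec l)
    (hm : Primrec m) : Primrec fun p => ofDist (a p) (l p) (m p) :=
  (primrec_ofCoeffs ha (primrec_commonDen.comp (list_append.comp hl hm)) hl).pair
    (primrec_ofCoeffs ha (primrec_commonDen.comp (list_append.comp hl hm)) hm)

theorem primrec_add (hf : Primrec f) (hg : Primrec g) : Primrec fun p => (f p).add (g p) :=
  (list_append.comp (primrec_mul.comp (fst.comp hf) (snd.comp hg))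
    (primrec_mul.comp (fst.comp hg) (snd.comp hf))).pair
    (primrec_mul.comp (snd.comp hf) (snd.comp hg))

theorem primrec_neg (hf : Primrec f) : Primrec fun p => (f p).neg :=
  (WPoly.primrec_neg.comp (fst.comp hf)).pair (snd.comp hf)

theorem primrec_scale {w : α → List ℕ} (hw : Primrec w) (hf : Primrec f) :
    Primrec fun p => (f p).scale (w p) :=
  (primrec_mul.comp (list_cons.comp hw (const [])) (fst.comp hf)).pair (snd.comp hf)

theorem primrec_cancel {rem quot : ℕ → WPoly → WPoly} (hr : Primrec₂ rem) (hq : Primrec₂ quot)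
    (hk : Primrec k) (ha : Primrec a) (hf : Primrec f) :
    Primrec fun p => (f p).cancel (k p) (rem (a p)) (quot (a p)) := by
  refine nat_iterate (h := fun p g => cancelStep (k p) (rem (a p)) (quot (a p)) g)
    (succ.comp (list_length.comp (list_flatten.comp (snd.comp hf)))) hf ?_
  have ha' : Primrec fun p : α × Frac => a p.1 := ha.comp fst
  exact Primrec.ite
    (primrecPred_isZero (hk.comp fst) (hr.comp ha' (snd.comp snd)))
    ((hq.comp ha' (fst.comp snd)).pair (hq.comp ha' (snd.comp snd))) snd

theorem primrec_cancel₀ (hk : Primrec k) (ha : Primrec a) (hf : Primrec f) :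
    Primrec fun p => (f p).cancel₀ (k p) (a p) :=
  primrec_cancel primrec_rem₀ primrec_quot₀ hk ha hf

theorem primrec_cancel₁ (hk : Primrec k) (ha : Primrec a) (hf : Primrec f) :
    Primrec fun p => (f p).cancel₁ (k p) (a p) :=
  primrec_cancel primrec_rem₁ primrec_quot₁ hk ha hf

theorem primrec_eval₀ (hk : Primrec k) (ha : Primrec a) (hf : Primrec f) :
    Primrec fun p => (f p).eval₀ (k p) (a p) :=
  (primrec_rem₀.comp ha (fst.comp (primrec_cancel₀ hk ha hf))).pair
    (primrec_rem₀.comp ha (snd.comp (primrec_cancel₀ hk ha hf)))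

theorem primrec_eval₁ (hk : Primrec k) (ha : Primrec a) (hf : Primrec f) :
    Primrec fun p => (f p).eval₁ (k p) (a p) :=
  (primrec_rem₁.comp ha (fst.comp (primrec_cancel₁ hk ha hf))).pair
    (primrec_rem₁.comp ha (snd.comp (primrec_cancel₁ hk ha hf)))

theorem primrec_shiftAux (ha : Primrec a) (hf : Primrec f) :
    Primrec fun p => shiftAux (a p) (f p) :=
  (list_append.comp
    (primrec_mul.comp (primrec_quot₀.comp ha (fst.comp hf)) (primrec_rem₀.comp ha (snd.comp hf)))
    (WPoly.primrec_neg.comp (primrec_mul.comp (primrec_rem₀.comp ha (fst.comp hf))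
      (primrec_quot₀.comp ha (snd.comp hf))))).pair
    (primrec_mul.comp (snd.comp hf) (primrec_rem₀.comp ha (snd.comp hf)))

theorem primrec_shift (hk : Primrec k) (ha : Primrec a) (hf : Primrec f) :
    Primrec fun p => (f p).shift (k p) (a p) :=
  primrec_shiftAux ha (primrec_cancel₀ hk ha hf)

theorem primrec_decr (hk : Primrec k) (ha : Primrec a) (hf : Primrec f) :
    Primrec fun p => (f p).decr (k p) (a p) :=
  primrec_add (primrec_shift hk ha hf) (primrec_eval₀ hk ha hf)

theorem primrec_assign {n : α → ℕ} (hk : Primrec k) (ha : Primrec a) (hn : Primrec n)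
    (hf : Primrec f) : Primrec fun p => (f p).assign (k p) (a p) (n p) :=
  primrec_scale (primrec_replicate hn ha) (primrec_eval₁ hk ha hf)

theorem primrec_ge {n : α → ℕ} (hk : Primrec k) (ha : Primrec a) (hn : Primrec n)
    (hf : Primrec f) : Primrec fun p => (f p).ge (k p) (a p) (n p) :=
  primrec_scale (primrec_replicate hn ha)
    (nat_iterate hn hf (primrec_shift (hk.comp fst) (ha.comp fst) snd).to₂)

theorem primrec_lt {n : α → ℕ} (hk : Primrec k) (ha : Primrec a) (hn : Primrec n)
    (hf : Primrec f) : Primrec fun p => (f p).lt (k p) (a p) (n p) :=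
  primrec_add hf (primrec_neg (primrec_ge hk ha hn hf))

theorem primrec_subst (hk : Primrec k) (ha : Primrec a) (hf : Primrec f) (hg : Primrec g) :
    Primrec fun p => (f p).subst (k p) (a p) (g p) := by
  have hM : Primrec fun p => (f p).1.flatten.length + (f p).2.flatten.length :=
    nat_add.comp (list_length.comp (list_flatten.comp (fst.comp hf)))
      (list_length.comp (list_flatten.comp (snd.comp hf)))
  exact Primrec.ite (primrecPred_isZero hk (fst.comp hg)) (primrec_eval₀ hk ha hf)
    ((primrec_homSubst ha (fst.comp hg) (snd.comp hg) hM (fst.comp hf)).pair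
      (primrec_homSubst ha (fst.comp hg) (snd.comp hg) hM (snd.comp hf)))

theorem primrec_varLetter (ha : Primrec a) : Primrec fun p => varLetter (a p) :=
  succ.comp (nat_mul.comp (const 2) ha)

theorem primrec_iid {x y c : α → ℕ} (hk : Primrec k) (hx : Primrec x) (hy : Primrec y)
    (hc : Primrec c) (hf : Primrec f) :
    Primrec fun p => (f p).iid (k p) (x p) (y p) (c p) :=
  primrec_subst hk (primrec_varLetter hy) hf (primrec_ofDist (primrec_varLetter hx)
    (primrec_decodeCoeffs.comp (fst.comp (unpair.comp hc)))
    (primrec_decodeCoeffs.comp (snd.comp (unpair.comp hc))))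

theorem primrec_exec {s : α → List Frac} {c : α → ℕ × ℕ} (hk : Primrec k) (hs : Primrec s)
    (hc : Primrec c) : Primrec fun p => exec (k p) (s p) (c p) := by
  have h1 : Primrec fun p => (c p).1 := fst.comp hc
  have h2 : Primrec fun p => (c p).2 := snd.comp hc
  have hl : Primrec fun p => (c p).2.unpair.1 := fst.comp (unpair.comp h2)
  have hr : Primrec fun p => (c p).2.unpair.2 := snd.comp (unpair.comp h2)
  have hh : Primrec fun p => (s p).headI := list_headI.comp hs
  have ht : Primrec fun p => (s p).tail := list_tail.comp hs
  have hth : Primrec fun p => (s p).tail.headI := list_headI.comp ht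
  have htt : Primrec fun p => (s p).tail.tail := list_tail.comp ht
  have hv := primrec_varLetter hl
  refine Primrec.ite (Primrec.eq.comp h1 (const 0))
    (list_cons.comp (primrec_assign hk hv hr hh) ht) ?_
  refine Primrec.ite (Primrec.eq.comp h1 (const 1))
    (list_cons.comp (primrec_decr hk (primrec_varLetter h2) hh) ht) ?_
  refine Primrec.ite (Primrec.eq.comp h1 (const 2))
    (list_cons.comp (primrec_iid hk hl (snd.comp (unpair.comp hr)) (fst.comp (unpair.comp hr)) hh)
      ht) ?_
  refine Primrec.ite (Primrec.eq.comp h1 (const 3))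
    (list_cons.comp (primrec_lt hk hv hr hh) (list_cons.comp (primrec_ge hk hv hr hh) ht)) ?_
  exact Primrec.ite (Primrec.eq.comp h1 (const 4))
    (list_cons.comp hth (list_cons.comp hh htt)) (list_cons.comp (primrec_add hh hth) htt)

theorem primrec_run {l : α → List (ℕ × ℕ)} {s : α → List Frac} (hk : Primrec k)
    (hl : Primrec l) (hs : Primrec s) : Primrec fun p => run (k p) (l p) (s p) :=
  list_foldl hl hs (primrec_exec (hk.comp fst) (fst.comp snd) (snd.comp snd)).to₂

theorem primrec_init : Primrec init := by
  have hj : Primrec fun p : ℕ × ℕ × WPoly => 2 * p.2.1 :=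
    nat_mul.comp (const 2) (fst.comp snd)
  have hw : Primrec fun p : ℕ × ℕ × WPoly => ([[], [0, 2 * p.2.1 + 1, 2 * p.2.1 + 2]] : WPoly) :=
    list_cons.comp (const []) (list_cons.comp (list_cons.comp (const 0) (list_cons.comp
      (succ.comp hj) (list_cons.comp (succ.comp (succ.comp hj)) (const [])))) (const []))
  exact (const [[]]).pair (list_foldr list_range (const [[]])
    (primrec_mul.comp hw (snd.comp snd)).to₂)

end Frac

/-! ### Primitive recursiveness of compilation and of the decision procedure. -/

theorem primrec_compileStep : Primrec compileStep := by
  have hn : Primrec fun l : List (List (ℕ × ℕ)) => l.length.unpair := unpair.comp list_length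
  have h1 : Primrec fun l : List (List (ℕ × ℕ)) => l.length.unpair.1 := fst.comp hn
  have h2 : Primrec fun l : List (List (ℕ × ℕ)) => l.length.unpair.2.unpair :=
    unpair.comp (snd.comp hn)
  have h3 : Primrec fun l : List (List (ℕ × ℕ)) => l.length.unpair.2.unpair.2.unpair :=
    unpair.comp (snd.comp h2)
  have hget {i : List (List (ℕ × ℕ)) → ℕ} (hi : Primrec i) :
      Primrec fun l : List (List (ℕ × ℕ)) => l.getD (i l) [] :=
    (list_getD []).comp Primrec.id hi
  refine Primrec.ite (nat_le.comp h1 (const 2)) (list_cons.comp hn (const [])) ?_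
  refine Primrec.ite (Primrec.eq.comp h1 (const 3)) ?_
    (list_append.comp (hget (fst.comp h2)) (hget (snd.comp h2)))
  exact list_cons.comp ((const 3).pair (fst.comp h2)) (list_append.comp (hget (fst.comp h3))
    (list_cons.comp (const (4, 0)) (list_append.comp (hget (snd.comp h3)) (const [(5, 0)]))))

theorem primrec_compile : Primrec compile :=
  primrec_compileStep.comp (nat_rec₁ []
    (list_append.comp snd (list_cons.comp (primrec_compileStep.comp snd) (const []))).to₂)

theorem primrec_closedForm : Primrec₂ closedForm :=
  list_headI.comp (Frac.primrec_run fst (primrec_compile.comp snd)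
    (list_cons.comp (Frac.primrec_init.comp fst) (const [])))

theorem primrec_decideEquiv : Primrec decideEquiv := by
  have h1 : Primrec fun p : ℕ × ℕ × ℕ => closedForm p.1 p.2.1 :=
    primrec_closedForm.comp fst (fst.comp snd)
  have h2 : Primrec fun p : ℕ × ℕ × ℕ => closedForm p.1 p.2.2 :=
    primrec_closedForm.comp fst (snd.comp snd)
  exact (WPoly.primrecPred_isZero fst (list_append.comp
    (WPoly.primrec_mul.comp (fst.comp h1) (snd.comp h2))
    (WPoly.primrec_neg.comp (WPoly.primrec_mul.comp (fst.comp h2) (snd.comp h1))))).decide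

end
end ReDiP

theorem mainTheorem2 :
    ∃ decide : ℕ × ℕ × ℕ → Bool, Computable decide ∧
      ∀ (k : ℕ) (P₁ P₂ : ReDiP.Prog k), P₁.LoopFree → P₂.LoopFree → P₁.Valid → P₂.Valid →
        (decide (k, P₁.code, P₂.code) = true ↔ P₁.Equivalent P₂) :=
  ⟨ReDiP.decideEquiv, ReDiP.primrec_decideEquiv.to_comp, fun _ _ _ h₁ h₂ v₁ v₂ =>
    ReDiP.decideEquiv_iff h₁ h₂ v₁ v₂⟩
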